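/- Let $\mathbf K$ be $\mathbb R$ or $\mathbb C$, let $q\in\mathbf K$ be generic (nonzero and not a root of unity), and let $c,\tau\in\mathbf K$ be nonzero. Let $\mathbf V=\mathrm{Span}(u,v,w)$ be the $U_q(sl(2))$-module with $$X.u=0,\ X.v=-(q+q^{-1})u,\ X.w=v;\quad Y.u=-v,\ Y.v=(q+q^{-1})w,\ Y.w=0;\quad H.u=2u,\ H.v=0,\ H.w=-2w,$$ extended to the tensor powers $\mathbf V^{\otimes k}$ by $\Delta(X)=X\otimes 1+q^{-H}\otimes X$, $\Delta(Y)=1\otimes Y+Y\otimes q^H$, $\Delta(H)=H\otimes 1+1\otimes H$. Let $\mathbf V_k^q=\mathrm{Span}\{Y^i u^{\otimes k}: i\ge 0\}\subset\mathbf V^{\otimes k}$ be the spin-$k$ component. The algebra $\mathcal A=\mathcal A_{0,q}^c$ of the quantum hyperboloid $H_q$ is the quotient of the tensor algebra $T(\mathbf V)$ by the two-sided ideal generated by $$q^2uv-vu,\quad (q^3+q)(uw-wu)+(1-q^2)vv,\quad -q^2vw+wv,\quad (q^3+q)uw+vv+(q+q^{-1})wu-c .$$ The braided Lie algebra $sl(2)_q$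 is $\mathbf V$ with the bilinear bracket given, with $M=(1+q^4)^{-1}\tau$, by $$[u,u]_q=0,\ [u,v]_q=-q^2Mu,\ [u,w]_q=(q+q^{-1})^{-1}Mv,\ [v,u]_q=Mu,\ [v,v]_q=(1-q^2)Mv,$$ $$[v,w]_q=-q^2Mw,\ [w,u]_q=-(q+q^{-1})^{-1}Mv,\ [w,v]_q=Mw,\ [w,w]_q=0 .$$ With $\kappa=1-(q^2+q^{-2})^{-1}$, the braided enveloping algebra $U(sl(2)_q)$ is the quotient of $T(\mathbf V)$ by the relations $$q^2uv-vu=\kappa\,(q^2[u,v]_q-[v,u]_q),$$ $$(q^3+q)(uw-wu)+(1-q^2)vv=\kappa\,\big((q^3+q)([u,w]_q-[w,u]_q)+(1-q^2)[v,v]_q\big),$$ $$-q^2vw+wv=\kappa\,(-q^2[v,w]_q+[w,v]_q).$$ The tangent module $T(H_q)$ is the quotient of the free left $\mathcal A$-module with basis $U^q,V^q,W^q$ by the submodule generated by $(q^3+q)uW^q+vV^q+(q+q^{-1})wU^q$. Write $x\mapsto x'$ for the linear map $\mathbf V\to T(H_q)$ with $u'=U^q$, $v'=V^q$, $w'=W^q$.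 **Theorem.** The algebra $\mathcal A$ is the direct sum of its spin components: the canonical map $\bigoplus_{k\ge 0}\mathbf V_k^q\to\mathcal A$ is a linear isomorphism. For every $k$ there is a $U_q(sl(2))$-equivariant projector $P_k^q:\mathbf V^{\otimes k}\to\mathbf V_k^q$, and there is a linear map $\beta:T(H_q)\otimes_{\mathbf K}\mathcal A\to\mathcal A$ such that, writing $x'(f)=\beta(x'\otimes f)$: 1. $\beta(aZ\otimes f)=a\,\beta(Z\otimes f)$ for all $a,f\in\mathcal A$ and $Z\in T(H_q)$ (so the square formed by $\beta$ and the left multiplications by $\mathcal A$ commutes). 2. There is an algebra homomorphism $\rho:U(sl(2)_q)\to\mathrm{End}_{\mathbf K}(\mathcal A)$ with $\rho(x)=\beta(x'\otimes\,\cdot\,)$ for all $x\in\mathbf V$, and for all $f\in\mathcal A$ $$(q^3+q)\,u\,W^q(f)+v\,V^q(f)+(q+q^{-1})\,w\,U^q(f)=0 .$$ 3. The operators extend the braided adjoint action and are built componentwise: $x'(1)=0$ and $x'(z)=[x,z]_q$ for $x,z\in\mathbf V$, and for all $k\ge1$, $x\in\mathbf V$ and $t\in\mathbf V_k^q\subset\mathbf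 V^{\otimes k}$ (tensors being identified with their images in $\mathcal A$), $$x'(t)=\alpha_k\,P_k^q\big([x,\cdot]_q\otimes\mathrm{id}^{\otimes(k-1)}\big)(t),\qquad \alpha_k=\frac{(q^{-1}+q^{5})(1+q^4+\dots+q^{4(k-1)})}{q^{-1}+q^{4k+1}} .$$ -/

import Mathlib

open scoped TensorProduct

namespace QuantumHyperboloid

noncomputable section

/-- The parameter `q` is generic: nonzero and not a root of unity. -/
def IsGeneric {K : Type*} [Field K] (q : K) : Prop :=
  q ≠ 0 ∧ ∀ n : ℕ, 0 < n → q ^ n ≠ 1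

/-- The space `V = Span(u, v, w)`; the coordinates `0, 1, 2` are those along `u, v, w`. -/
abbrev V (K : Type*) : Type _ := Fin 3 → K

/-- The basis vector `u` of `V`. -/
def u {K : Type*} [Field K] : V K := ![1, 0, 0]

/-- The basis vector `v` of `V`. -/
def v {K : Type*} [Field K] : V K := ![0, 1, 0]

/-- The basis vector `w` of `V`. -/
def w {K : Type*} [Field K] : V K := ![0, 0, 1]

/-- The tensor algebra `T(V)`. -/
abbrev T (K : Type*) [Field K] : Type _ := TensorAlgebra K (V K)

/-- The inclusion `V → T(V)`. -/
abbrev ι {K : Type*} [Field K] : V K →ₗ[K] T K := TensorAlgebra.ι K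

/-- The subspace `V^{⊗ k}` of `T(V)`. -/
def tensors (K : Type*) [Field K] (k : ℕ) : Submodule K (T K) :=
  (LinearMap.range (ι (K := K))) ^ k

/-! ### The action of `U_q(sl(2))` on `V` and on tensors -/

/-- The action of the generator `X` on `V`: `u ↦ 0`, `v ↦ -(q + q⁻¹) u`, `w ↦ v`. -/
def actX {K : Type*} [Field K] (q : K) : V K →ₗ[K] V K :=
  Matrix.toLin' !![0, -(q + q⁻¹), 0; 0, 0, 1; 0, 0, 0]

/-- The action of the generator `Y` on `V`: `u ↦ -v`, `v ↦ (q + q⁻¹) w`, `w ↦ 0`. -/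
def actY {K : Type*} [Field K] (q : K) : V K →ₗ[K] V K :=
  Matrix.toLin' !![0, 0, 0; -1, 0, 0; 0, q + q⁻¹, 0]

/-- The action of the generator `H` on `V`: `u ↦ 2 u`, `v ↦ 0`, `w ↦ -2 w`. -/
def actH {K : Type*} [Field K] : V K →ₗ[K] V K :=
  Matrix.toLin' !![2, 0, 0; 0, 0, 0; 0, 0, -2]

/-- The action of `q^H` on `V`: `u ↦ q² u`, `v ↦ v`, `w ↦ q⁻² w`
(so that `actqH q⁻¹` is the action of `q^{-H}`). -/
def actqH {K : Type*} [Field K] (q : K) : V K →ₗ[K] V K :=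
  Matrix.toLin' !![q ^ 2, 0, 0; 0, 1, 0; 0, 0, (q ^ 2)⁻¹]

/-- The algebra endomorphism of `T(V)` that extends `σ : V → V`; on `V^{⊗ k}` it is
`σ^{⊗ k}`. -/
def groupLike {K : Type*} [Field K] (σ : V K →ₗ[K] V K) : T K →ₐ[K] T K :=
  TensorAlgebra.lift K (ι ∘ₗ σ)

theorem groupLike_ι {K : Type*} [Field K] (σ : V K →ₗ[K] V K) (x : V K) :
    groupLike σ (ι x) = ι (σ x) := by
  simp [groupLike]

theorem groupLike_id {K : Type*} [Field K] (t : T K) :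
    groupLike (LinearMap.id : V K →ₗ[K] V K) t = t := by
  have h : groupLike (LinearMap.id : V K →ₗ[K] V K) = AlgHom.id K (T K) := by
    apply TensorAlgebra.hom_ext
    ext x
    simp [groupLike]
  rw [h]
  rfl

/-- Auxiliary upper triangular homomorphism: on `V` it is `x ↦ (σ x, d x; 0, ρ x)`. -/
def triangular {K : Type*} [Field K] (σ ρ d : V K →ₗ[K] V K) :
    T K →ₐ[K] Matrix (Fin 2) (Fin 2) (T K) :=
  TensorAlgebra.lift K
    { toFun := fun x => !![ι (σ x), ι (d x); 0, ι (ρ x)]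
      map_add' := by
        intro x y
        ext i j
        fin_cases i <;> fin_cases j <;> simp
      map_smul' := by
        intro a x
        ext i j
        fin_cases i <;> fin_cases j <;> simp }

/-- The linear operator on `T(V)` that extends `d : V → V` by means of the coproduct
`Δ(d) = d ⊗ ρ + σ ⊗ d`, where `σ` and `ρ` act as group-like elements: on `V^{⊗ k}` it is
`∑ i, σ^{⊗ i} ⊗ d ⊗ ρ^{⊗ (k - 1 - i)}`. See `skew_one`, `skew_ι`, `skew_mul`. -/
def skew {K : Type*} [Field K] (σ ρ d : V K →ₗ[K] V K) : Module.End K (T K) :=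
  { toFun := fun t => triangular σ ρ d t 0 1
    map_add' := fun s t => by simp
    map_smul' := fun a t => by simp }

theorem triangular_entries {K : Type*} [Field K] (σ ρ d : V K →ₗ[K] V K) (t : T K) :
    triangular σ ρ d t 0 0 = groupLike σ t ∧ triangular σ ρ d t 1 0 = 0 ∧
      triangular σ ρ d t 1 1 = groupLike ρ t := by
  induction t using TensorAlgebra.induction with
  | algebraMap r => simp [Matrix.algebraMap_matrix_apply]
  | ι x => simp [triangular, groupLike_ι]
  | mul a b ha hb =>
    obtain ⟨a1, a2, a3⟩ := ha
    obtain ⟨b1, b2, b3⟩ := hb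
    simp [Matrix.mul_apply, Fin.sum_univ_two, a1, a2, a3, b1, b2, b3]
  | add a b ha hb =>
    obtain ⟨a1, a2, a3⟩ := ha
    obtain ⟨b1, b2, b3⟩ := hb
    simp [a1, a2, a3, b1, b2, b3]

theorem skew_one {K : Type*} [Field K] (σ ρ d : V K →ₗ[K] V K) : skew σ ρ d 1 = 0 := by
  simp [skew]

theorem skew_ι {K : Type*} [Field K] (σ ρ d : V K →ₗ[K] V K) (x : V K) :
    skew σ ρ d (ι x) = ι (d x) := by
  simp [skew, triangular]

theorem skew_mul {K : Type*} [Field K] (σ ρ d : V K →ₗ[K] V K) (a b : T K) :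
    skew σ ρ d (a * b) =
      skew σ ρ d a * groupLike ρ b + groupLike σ a * skew σ ρ d b := by
  have ha := triangular_entries σ ρ d a
  have hb := triangular_entries σ ρ d b
  simp [skew, Matrix.mul_apply, Fin.sum_univ_two, ha.1, hb.2.2, add_comm]

/-- The action of `X` on `T(V)`, with `Δ(X) = X ⊗ 1 + q^{-H} ⊗ X`. -/
def tensorX {K : Type*} [Field K] (q : K) : Module.End K (T K) :=
  skew (actqH q⁻¹) LinearMap.id (actX q)

/-- The action of `Y` on `T(V)`, with `Δ(Y) = 1 ⊗ Y + Y ⊗ q^H`. -/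
def tensorY {K : Type*} [Field K] (q : K) : Module.End K (T K) :=
  skew LinearMap.id (actqH q) (actY q)

/-- The action of `H` on `T(V)`, with `Δ(H) = H ⊗ 1 + 1 ⊗ H`. -/
def tensorH {K : Type*} [Field K] : Module.End K (T K) :=
  skew LinearMap.id LinearMap.id actH

/-- The action of `q^H` on `T(V)`, with `Δ(q^H) = q^H ⊗ q^H`. -/
def tensorqH {K : Type*} [Field K] (q : K) : Module.End K (T K) :=
  (groupLike (actqH q)).toLinearMap

/-- The spin `k` component `V_k^q ⊆ V^{⊗ k}`: the irreducible `U_q(sl(2))`-module generated by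
the highest weight vector `u^{⊗ k}`, i.e. the span of the vectors `Y^i u^{⊗ k}`. -/
def spin {K : Type*} [Field K] (q : K) (k : ℕ) : Submodule K (T K) :=
  Submodule.span K (Set.range fun i : ℕ => (tensorY q ^ i) (ι u ^ k))

/-- `P`, restricted to `V^{⊗ k}`, is the braided projector `P_k^q : V^{⊗ k} → V_k^q`: a
projection onto `V_k^q` that is a morphism of `U_q(sl(2))`-modules. (The values of `P` outside
`V^{⊗ k}` are irrelevant.) -/
structure IsBraidedProjector {K : Type*} [Field K] (q : K) (k : ℕ) (P : Module.End K (T K)) :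
    Prop where
  mem_spin : ∀ t ∈ tensors K k, P t ∈ spin q k
  eq_self : ∀ t ∈ spin q k, P t = t
  comm_X : ∀ t ∈ tensors K k, P (tensorX q t) = tensorX q (P t)
  comm_Y : ∀ t ∈ tensors K k, P (tensorY q t) = tensorY q (P t)
  comm_H : ∀ t ∈ tensors K k, P (tensorH t) = tensorH (P t)
  comm_qH : ∀ t ∈ tensors K k, P (tensorqH q t) = tensorqH q (P t)

/-! ### The braided Lie algebra `sl(2)_q` and its enveloping algebra -/

/-- The braided Lie bracket `[x, y]_q` on `V`, with `M = (1 + q⁴)⁻¹ τ`. -/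
def bracket {K : Type*} [Field K] (q τ : K) : V K →ₗ[K] V K →ₗ[K] V K :=
  LinearMap.mk₂ K
    (fun x y => ((1 + q ^ 4)⁻¹ * τ) •
      ![-q ^ 2 * (x 0 * y 1) + x 1 * y 0,
        (q + q⁻¹)⁻¹ * (x 0 * y 2) - (q + q⁻¹)⁻¹ * (x 2 * y 0) + (1 - q ^ 2) * (x 1 * y 1),
        -q ^ 2 * (x 1 * y 2) + x 2 * y 1])
    (by intro x y z; ext i; fin_cases i <;> simp <;> ring)
    (by intro a x y; ext i; fin_cases i <;> simp <;> ring)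
    (by intro x y z; ext i; fin_cases i <;> simp <;> ring)
    (by intro a x y; ext i; fin_cases i <;> simp <;> ring)

/-- The bracket vanishes on the `q`-symmetric part `V_0^q ⊕ V_2^q` of `V ⊗ V`. -/
theorem bracket_symmetric {K : Type*} [Field K] (q τ : K) (hq : q ≠ 0) (h2 : q + q⁻¹ ≠ 0) :
    ((q ^ 3 + q) • bracket q τ u w + bracket q τ v v + (q + q⁻¹) • bracket q τ w u = 0) ∧
    bracket q τ u u = 0 ∧
    bracket q τ u v + q ^ 2 • bracket q τ v u = 0 ∧
    bracket q τ u w - q • bracket q τ v v + q ^ 4 • bracket q τ w u = 0 ∧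
    bracket q τ v w + q ^ 2 • bracket q τ w v = 0 ∧
    bracket q τ w w = 0 := by
  have h3 : q ^ 2 + 1 ≠ 0 := by
    intro h
    apply h2
    field_simp
    simpa using h
  refine ⟨?_, ?_, ?_, ?_, ?_, ?_⟩ <;> ext i <;> fin_cases i <;>
    simp [bracket, u, v, w] <;> field_simp <;> ring

/-- The values of the bracket on the `q`-antisymmetric part `V_1^q` of `V ⊗ V`. -/
theorem bracket_antisymmetric {K : Type*} [Field K] (q τ : K) (hq : q ≠ 0)
    (h2 : q + q⁻¹ ≠ 0) (h4 : 1 + q ^ 4 ≠ 0) :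
    q ^ 2 • bracket q τ u v - bracket q τ v u = -τ • u ∧
    (q ^ 3 + q) • (bracket q τ u w - bracket q τ w u) + (1 - q ^ 2) • bracket q τ v v =
      τ • v ∧
    -(q ^ 2 • bracket q τ v w) + bracket q τ w v = τ • w := by
  have h3 : q ^ 2 + 1 ≠ 0 := by
    intro h
    apply h2
    field_simp
    simpa using h
  refine ⟨?_, ?_, ?_⟩ <;> ext i <;> fin_cases i <;>
    simp [bracket, u, v, w] <;> field_simp <;> ring

/-- The constant `κ = 1 - (q² + q⁻²)⁻¹`. -/
def kappa {K : Type*} [Field K] (q : K) : K := 1 - (q ^ 2 + (q ^ 2)⁻¹)⁻¹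

/-- The defining relations `t = κ [t]_q`, for `t` in the basis of `V_1^q ⊆ V ⊗ V`, of the
braided enveloping algebra. -/
inductive EnvelopingRel {K : Type*} [Field K] (q τ : K) : T K → T K → Prop
  | rel_uv : EnvelopingRel q τ
      (q ^ 2 • (ι u * ι v) - ι v * ι u)
      (kappa q • ι (q ^ 2 • bracket q τ u v - bracket q τ v u))
  | rel_uw : EnvelopingRel q τ
      ((q ^ 3 + q) • (ι u * ι w - ι w * ι u) + (1 - q ^ 2) • (ι v * ι v))
      (kappa q • ι ((q ^ 3 + q) • (bracket q τ u w - bracket q τ w u) +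
        (1 - q ^ 2) • bracket q τ v v))
  | rel_vw : EnvelopingRel q τ
      (-(q ^ 2 • (ι v * ι w)) + ι w * ι v)
      (kappa q • ι (-(q ^ 2 • bracket q τ v w) + bracket q τ w v))

/-- The braided enveloping algebra `U(sl(2)_q)`. -/
abbrev Enveloping {K : Type*} [Field K] (q τ : K) : Type _ := RingQuot (EnvelopingRel q τ)

/-- The canonical map `sl(2)_q → U(sl(2)_q)`. -/
def toEnveloping {K : Type*} [Field K] (q τ : K) : V K →ₗ[K] Enveloping q τ :=
  (RingQuot.mkAlgHom K (EnvelopingRel q τ)).toLinearMap ∘ₗ ι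

/-! ### The quantum hyperboloid and its tangent module -/

/-- The defining relations of the algebra of functions on the quantum hyperboloid. -/
inductive HyperboloidRel {K : Type*} [Field K] (q c : K) : T K → T K → Prop
  | rel_uv : HyperboloidRel q c (q ^ 2 • (ι u * ι v) - ι v * ι u) 0
  | rel_uw : HyperboloidRel q c
      ((q ^ 3 + q) • (ι u * ι w - ι w * ι u) + (1 - q ^ 2) • (ι v * ι v)) 0
  | rel_vw : HyperboloidRel q c (-(q ^ 2 • (ι v * ι w)) + ι w * ι v) 0
  | casimir : HyperboloidRel q c
      ((q ^ 3 + q) • (ι u * ι w) + ι v * ι v + (q + q⁻¹) • (ι w * ι u)) (algebraMap K (T K) c)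

/-- The algebra `A_{0,q}^c` of functions on the quantum hyperboloid. -/
abbrev Hyperboloid {K : Type*} [Field K] (q c : K) : Type _ := RingQuot (HyperboloidRel q c)

/-- The projection `T(V) → A_{0,q}^c`. -/
def toHyperboloid {K : Type*} [Field K] (q c : K) : T K →ₐ[K] Hyperboloid q c :=
  RingQuot.mkAlgHom K (HyperboloidRel q c)

/-- The inclusion of the generators `V → A_{0,q}^c`. -/
def gen {K : Type*} [Field K] (q c : K) : V K →ₗ[K] Hyperboloid q c :=
  (toHyperboloid q c).toLinearMap ∘ₗ ι

/-- The left submodule of `(A_{0,q}^c)³` generated by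
`(q³ + q) u W^q + v V^q + (q + q⁻¹) w U^q`; the coordinates `0, 1, 2` are those along
`U^q, V^q, W^q`. -/
def tangentRel {K : Type*} [Field K] (q c : K) :
    Submodule (Hyperboloid q c) (Fin 3 → Hyperboloid q c) :=
  Submodule.span (Hyperboloid q c)
    {![(q + q⁻¹) • gen q c w, gen q c v, (q ^ 3 + q) • gen q c u]}

/-- The (left) tangent module `T(H_q)` of the quantum hyperboloid. -/
abbrev Tangent {K : Type*} [Field K] (q c : K) : Type _ :=
  (Fin 3 → Hyperboloid q c) ⧸ tangentRel q c

/-- The map `x ↦ x'` from `sl(2)_q` to the tangent module, given by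
`u ↦ U^q`, `v ↦ V^q`, `w ↦ W^q`. -/
def anchor {K : Type*} [Field K] (q c : K) : V K →ₗ[K] Tangent q c :=
  ((tangentRel q c).mkQ.restrictScalars K) ∘ₗ
    LinearMap.pi fun i => Algebra.linearMap K (Hyperboloid q c) ∘ₗ LinearMap.proj i

/-- The operator `ad^q x ⊗ id_{k-1}` on `V^{⊗ k}`, for all `k ≥ 1` simultaneously, where
`ad^q x (y) = [x, y]_q`. -/
def adFirst {K : Type*} [Field K] (q τ : K) (x : V K) : Module.End K (T K) :=
  skew 0 LinearMap.id (bracket q τ x)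

/-- `adFirst` acts on the first tensor factor only. -/
theorem adFirst_ι_mul {K : Type*} [Field K] (q τ : K) (x y : V K) (t : T K) :
    adFirst q τ x (ι y * t) = ι (bracket q τ x y) * t := by
  simp [adFirst, skew_mul, skew_ι, groupLike_id, groupLike_ι]

/-- The constants
`α_k = (q⁻¹ + q⁵) (1 + q⁴ + ⋯ + q^{4(k-1)}) (q⁻¹ + q^{4k+1})⁻¹`. -/
def alpha {K : Type*} [Field K] (q : K) (k : ℕ) : K :=
  (q⁻¹ + q ^ 5) * (∑ i ∈ Finset.range k, q ^ (4 * i)) * (q⁻¹ + q ^ (4 * k + 1))⁻¹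

end

end QuantumHyperboloid

/-!
The quantum group acts on the tensor algebra `T(V)` through its coproduct, and the defining
relations of the quantum hyperboloid `A` are stable under this action, so that it acts on `A` too
(`descends_skew`, `quantumRel_hyp`).

*Decomposition.* The vectors `Y^i u^{⊗ k}`, `0 ≤ i ≤ 2k`, span `V_k^q`; the next one vanishes,
since its weight does not occur in `V^{⊗ k}` (`spinVec_eq_zero`). Their images in `A` do not
vanish: applying `X` leads back to `u^k`, and `u^k ≠ 0` by a one-dimensional representation of
`A`. The Casimir operator takes the distinct values `q^{2k+1} + q^{-2k-1}` on the components, and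
`q^H` separates the vectors of one component; hence the sum of the `V_k^q` embeds into `A`
(`fromSpin_injective`). On the other hand the defining relations write every element of degree at
most `n` in terms of `∑_{k ≤ n} (2k + 1)` ordered monomials, which is the dimension of
`⨁_{k ≤ n} V_k^q`, so the embedding is onto (`monomialSpan_eq`, `fromSpin_surjective`). The projector `P_k^q`
sends a tensor to the spin `k` component of its image in `A`; it is equivariant because the map
from `T(V)` to `A` is.

*Vector fields.* The elements `X q^H`, `q⁻² X Y - Y X`, `q⁻² Y` of the quantum group span a copy
of `V` under the adjoint action (`adjointVec`). Their `q`-antisymmetric products are, up to sign,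
the Casimir element times these elements (`QuantumRel.adjointVec_relations`). Since the values of
the Casimir operator on `A` are nonzero, it is invertible there, and the operators
`x' = κ τ (Casimir)⁻¹ (element of index x)` represent the braided enveloping algebra. Two further facts are
checked on the highest weight vectors `u^k` only, and extend to all of `A` because both sides
behave in the same way under `Y`: the relation between the operators (`vectorField_relation`), and
the agreement of `x'` with `α_k P_k^q ([x, ·]_q ⊗ id)` on `V_k^q` (`spinProj_adFirst`). By the
first of them, the action of the free module on `U^q`, `V^q`, `W^q` factors through the tangent
module.
-/

open scoped TensorProduct

namespace QuantumHyperboloid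

noncomputable section

variable {K : Type*} [Field K]

/-! ### The quantum group acting on tensors -/

theorem IsGeneric.pow_injective {q : K} (hq : IsGeneric q) {m n : ℕ} (h : q ^ m = q ^ n) :
    m = n := by
  wlog hmn : m ≤ n generalizing m n
  · exact (this h.symm (le_of_not_ge hmn)).symm
  obtain ⟨d, rfl⟩ := Nat.exists_eq_add_of_le hmn
  rcases Nat.eq_zero_or_pos d with rfl | hd
  · rfl
  · refine absurd ?_ (hq.2 d hd)
    have h0 : q ^ m ≠ 0 := pow_ne_zero _ hq.1
    apply mul_left_cancel₀ h0
    rw [← pow_add, ← h, mul_one]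

theorem IsGeneric.sub_inv_ne_zero {q : K} (hq : IsGeneric q) : q - q⁻¹ ≠ 0 := by
  intro h
  have h0 := hq.1
  apply hq.2 2 two_pos
  field_simp at h
  linear_combination h

theorem IsGeneric.one_add_pow_ne_zero {q : K} (hq : IsGeneric q) {n : ℕ} (hn : 0 < n) :
    1 + q ^ n ≠ 0 := by
  intro h
  apply hq.2 (2 * n) (by omega)
  rw [two_mul, pow_add]
  linear_combination (q ^ n - 1) * h

theorem IsGeneric.add_inv_ne_zero {q : K} (hq : IsGeneric q) : q + q⁻¹ ≠ 0 := by
  intro h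
  have h0 := hq.1
  apply hq.one_add_pow_ne_zero two_pos
  field_simp at h
  linear_combination h

theorem vec_eq (x : V K) : x = x 0 • u + x 1 • v + x 2 • w := by
  ext i; fin_cases i <;> simp [u, v, w]

theorem actX_u (q : K) : actX q u = 0 := by
  ext i; fin_cases i <;> simp [actX, u, Matrix.mulVec, dotProduct, Fin.sum_univ_three]

theorem actX_v (q : K) : actX q v = -(q + q⁻¹) • u := by
  ext i; fin_cases i <;> simp [actX, u, v, Matrix.mulVec, dotProduct, Fin.sum_univ_three]

theorem actX_w (q : K) : actX q w = v := by
  ext i; fin_cases i <;> simp [actX, v, w, Matrix.mulVec, dotProduct, Fin.sum_univ_three]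

theorem actY_u (q : K) : actY q u = -v := by
  ext i; fin_cases i <;> simp [actY, u, v, Matrix.mulVec, dotProduct, Fin.sum_univ_three]

theorem actY_v (q : K) : actY q v = (q + q⁻¹) • w := by
  ext i; fin_cases i <;> simp [actY, v, w, Matrix.mulVec, dotProduct, Fin.sum_univ_three]

theorem actY_w (q : K) : actY q w = 0 := by
  ext i; fin_cases i <;> simp [actY, w, Matrix.mulVec, dotProduct, Fin.sum_univ_three]

theorem actH_u : actH (u : V K) = (2 : K) • u := by
  ext i; fin_cases i <;> simp [actH, u, Matrix.mulVec, dotProduct, Fin.sum_univ_three]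

theorem actH_v : actH (v : V K) = 0 := by
  ext i; fin_cases i <;> simp [actH, v, Matrix.mulVec, dotProduct, Fin.sum_univ_three]

theorem actH_w : actH (w : V K) = (-2 : K) • w := by
  ext i; fin_cases i <;> simp [actH, w, Matrix.mulVec, dotProduct, Fin.sum_univ_three]

theorem actqH_u (q : K) : actqH q u = q ^ 2 • u := by
  ext i; fin_cases i <;> simp [actqH, u, Matrix.mulVec, dotProduct, Fin.sum_univ_three]

theorem actqH_v (q : K) : actqH q v = v := by
  ext i; fin_cases i <;> simp [actqH, v, Matrix.mulVec, dotProduct, Fin.sum_univ_three]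

theorem actqH_w (q : K) : actqH q w = (q ^ 2)⁻¹ • w := by
  ext i; fin_cases i <;> simp [actqH, w, Matrix.mulVec, dotProduct, Fin.sum_univ_three]

/-- To compare two linear maps on `V` it suffices to compare them on `u`, `v`, `w`. -/
theorem hom_ext_basis {M : Type*} [AddCommGroup M] [Module K M] {f g : V K →ₗ[K] M}
    (hu : f u = g u) (hv : f v = g v) (hw : f w = g w) : f = g := by
  refine LinearMap.ext fun x => ?_
  rw [vec_eq x]
  simp only [map_add, map_smul, hu, hv, hw]

theorem tensorX_ι (q : K) (x : V K) : tensorX q (ι x) = ι (actX q x) := skew_ι _ _ _ _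
theorem tensorY_ι (q : K) (x : V K) : tensorY q (ι x) = ι (actY q x) := skew_ι _ _ _ _
theorem tensorH_ι (x : V K) : tensorH (ι x) = ι (actH x) := skew_ι _ _ _ _
theorem tensorqH_ι (q : K) (x : V K) : tensorqH q (ι x) = ι (actqH q x) := groupLike_ι _ _

theorem tensorX_one (q : K) : tensorX q 1 = 0 := skew_one _ _ _
theorem tensorY_one (q : K) : tensorY q 1 = 0 := skew_one _ _ _
theorem tensorH_one : tensorH (1 : T K) = 0 := skew_one _ _ _
theorem tensorqH_one (q : K) : tensorqH q 1 = 1 := map_one (groupLike (actqH q))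

theorem tensorX_mul (q : K) (a b : T K) :
    tensorX q (a * b) = tensorX q a * b + tensorqH q⁻¹ a * tensorX q b := by
  rw [tensorX, skew_mul, groupLike_id]; rfl

theorem tensorY_mul (q : K) (a b : T K) :
    tensorY q (a * b) = tensorY q a * tensorqH q b + a * tensorY q b := by
  rw [tensorY, skew_mul, groupLike_id]; rfl

theorem tensorH_mul (a b : T K) :
    tensorH (a * b) = tensorH a * b + a * tensorH b := by
  rw [tensorH, skew_mul, groupLike_id, groupLike_id]

theorem tensorqH_mul (q : K) (a b : T K) :
    tensorqH q (a * b) = tensorqH q a * tensorqH q b := map_mul (groupLike (actqH q)) a b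

/-- Two linear maps out of `T(V)` that agree on `1` and on `V`, and for which agreement is
inherited by products, are equal. -/
theorem tensor_ext {M : Type*} [AddCommGroup M] [Module K M] {f g : T K →ₗ[K] M}
    (h1 : f 1 = g 1) (hι : ∀ x, f (ι x) = g (ι x))
    (hmul : ∀ a b, f a = g a → f b = g b → f (a * b) = g (a * b)) : f = g := by
  ext1 t
  induction t using TensorAlgebra.induction with
  | algebraMap r => rw [Algebra.algebraMap_eq_smul_one, map_smul, map_smul, h1]
  | ι x => exact hι x
  | mul a b ha hb => exact hmul a b ha hb
  | add a b ha hb => rw [map_add, map_add, ha, hb]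

theorem tensorqH_inv_mul (q : K) (hq : q ≠ 0) : tensorqH q⁻¹ * tensorqH q = 1 := by
  refine tensor_ext (by simp [tensorqH_one]) (fun x => ?_) fun a b ha hb => ?_
  · have : actqH q⁻¹ ∘ₗ actqH q = LinearMap.id := by
      apply hom_ext_basis <;> simp [actqH_u, actqH_v, actqH_w, smul_smul, hq]
    simpa [tensorqH_ι] using congrArg ι (LinearMap.congr_fun this x)
  · simp only [Module.End.mul_apply, Module.End.one_apply] at *
    rw [tensorqH_mul, tensorqH_mul, ha, hb]

theorem tensorqH_mul_inv (q : K) (hq : q ≠ 0) : tensorqH q * tensorqH q⁻¹ = 1 := by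
  simpa using tensorqH_inv_mul q⁻¹ (inv_ne_zero hq)

theorem tensorqH_mul_tensorX (q : K) (hq : q ≠ 0) :
    tensorqH q * tensorX q = q ^ 2 • (tensorX q * tensorqH q) := by
  have hKK := LinearMap.congr_fun (tensorqH_inv_mul q hq)
  have hKK' := LinearMap.congr_fun (tensorqH_mul_inv q hq)
  refine tensor_ext (by simp [tensorqH_one, tensorX_one]) (fun x => ?_) fun a b ha hb => ?_
  · have : actqH q ∘ₗ actX q = q ^ 2 • (actX q ∘ₗ actqH q) := by
      apply hom_ext_basis <;>
        simp [actqH_u, actqH_v, actqH_w, actX_u, actX_v, actX_w, smul_smul, hq, mul_comm]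
    simpa [tensorqH_ι, tensorX_ι] using congrArg ι (LinearMap.congr_fun this x)
  · simp only [Module.End.mul_apply, LinearMap.smul_apply, Module.End.one_apply] at *
    simp only [tensorqH_mul, tensorX_mul, map_add, ha, hb, hKK, hKK', smul_mul_assoc,
      mul_smul_comm, smul_add]

theorem tensorqH_mul_tensorY (q : K) (hq : q ≠ 0) :
    tensorqH q * tensorY q = (q ^ 2)⁻¹ • (tensorY q * tensorqH q) := by
  refine tensor_ext (by simp [tensorqH_one, tensorY_one]) (fun x => ?_) fun a b ha hb => ?_
  · have : actqH q ∘ₗ actY q = (q ^ 2)⁻¹ • (actY q ∘ₗ actqH q) := by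
      apply hom_ext_basis <;>
        simp [actqH_u, actqH_v, actqH_w, actY_u, actY_v, actY_w, smul_smul, hq, mul_comm]
    simpa [tensorqH_ι, tensorY_ι] using congrArg ι (LinearMap.congr_fun this x)
  · simp only [Module.End.mul_apply, LinearMap.smul_apply] at *
    simp only [tensorqH_mul, tensorY_mul, map_add, ha, hb, smul_mul_assoc,
      mul_smul_comm, smul_add]

/-- Conjugation by an invertible element turns a `q`-commutation relation into the inverse
one. -/
theorem inv_commutation {R : Type*} [Ring R] [Algebra K R] {k k' x : R} {a : K} (ha : a ≠ 0)
    (h1 : k' * k = 1) (h2 : k * k' = 1) (h : k * x = a • (x * k)) :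
    k' * x = a⁻¹ • (x * k') := by
  have : k' * (k * x) * k' = a • (k' * x * (k * k')) := by
    rw [h]; simp [mul_assoc]
  rw [h2, mul_one, ← mul_assoc, h1, one_mul] at this
  rw [this, smul_smul, inv_mul_cancel₀ ha, one_smul]

theorem tensorqH_inv_mul_tensorX (q : K) (hq : q ≠ 0) :
    tensorqH q⁻¹ * tensorX q = (q ^ 2)⁻¹ • (tensorX q * tensorqH q⁻¹) :=
  inv_commutation (pow_ne_zero _ hq) (tensorqH_inv_mul q hq) (tensorqH_mul_inv q hq)
    (tensorqH_mul_tensorX q hq)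

theorem tensorqH_inv_mul_tensorY (q : K) (hq : q ≠ 0) :
    tensorqH q⁻¹ * tensorY q = q ^ 2 • (tensorY q * tensorqH q⁻¹) := by
  simpa using inv_commutation (inv_ne_zero (pow_ne_zero 2 hq)) (tensorqH_inv_mul q hq)
    (tensorqH_mul_inv q hq) (tensorqH_mul_tensorY q hq)

theorem tensorX_mul_tensorY (q : K) (hq : IsGeneric q) :
    tensorX q * tensorY q =
      tensorY q * tensorX q + (q - q⁻¹)⁻¹ • (tensorqH q - tensorqH q⁻¹) := by
  have h0 := hq.1
  have hs := hq.sub_inv_ne_zero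
  refine tensor_ext (by simp [tensorqH_one, tensorX_one, tensorY_one]) (fun x => ?_)
    fun a b ha hb => ?_
  · have : actX q ∘ₗ actY q =
        actY q ∘ₗ actX q + (q - q⁻¹)⁻¹ • (actqH q - actqH q⁻¹) := by
      have e : (q - q⁻¹)⁻¹ * (q ^ 2 - (q ^ 2)⁻¹) = q + q⁻¹ := by
        rw [inv_mul_eq_iff_eq_mul₀ hs]; field_simp; ring
      apply hom_ext_basis
      · simp [actqH_u, actX_u, actY_u, actX_v, ← sub_smul, smul_smul, e]
        module
      · simp [actqH_v, actX_v, actX_w, actY_u, actY_v]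
        module
      · simp only [LinearMap.comp_apply, LinearMap.add_apply, LinearMap.smul_apply,
          LinearMap.sub_apply, actqH_w, actX_w, actY_w, actY_v, map_zero, ← sub_smul, smul_smul,
          ← add_smul]
        rw [inv_pow, inv_inv, ← neg_sub (q ^ 2), mul_neg, e]
        simp
    simpa [tensorqH_ι, tensorX_ι, tensorY_ι] using congrArg ι (LinearMap.congr_fun this x)
  · have hX := LinearMap.congr_fun (tensorqH_mul_tensorX q h0) b
    have hY := LinearMap.congr_fun (tensorqH_inv_mul_tensorY q h0) a
    simp only [Module.End.mul_apply, LinearMap.smul_apply, LinearMap.add_apply,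
      LinearMap.sub_apply] at *
    simp only [tensorqH_mul, tensorX_mul, tensorY_mul, map_add, ha, hb, hX, hY, smul_mul_assoc,
      mul_smul_comm, add_mul, mul_add, smul_sub, sub_mul, mul_sub]
    abel

/-! ### The spin components of the tensor algebra -/

theorem tensorH_mul_tensorqH (q : K) : tensorH * tensorqH q = tensorqH q * tensorH := by
  refine tensor_ext (by simp [tensorqH_one, tensorH_one]) (fun x => ?_) fun a b ha hb => ?_
  · have : actH ∘ₗ actqH q = actqH q ∘ₗ actH := by
      apply hom_ext_basis <;>
        simp [actqH_u, actqH_v, actqH_w, actH_u, actH_v, actH_w, smul_smul, mul_comm]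
    simpa [tensorqH_ι, tensorH_ι] using congrArg ι (LinearMap.congr_fun this x)
  · simp only [Module.End.mul_apply] at *
    simp only [tensorqH_mul, tensorH_mul, map_add, ha, hb]

theorem tensorH_mul_tensorY (q : K) :
    tensorH * tensorY q = tensorY q * tensorH - (2 : K) • tensorY q := by
  refine tensor_ext (by simp [tensorH_one, tensorY_one]) (fun x => ?_) fun a b ha hb => ?_
  · have : actH ∘ₗ actY q = actY q ∘ₗ actH - (2 : K) • actY q := by
      apply hom_ext_basis <;> simp [actY_u, actY_v, actY_w, actH_u, actH_v, actH_w, smul_smul]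
      module
    simpa [tensorY_ι, tensorH_ι] using congrArg ι (LinearMap.congr_fun this x)
  · have hb' := LinearMap.congr_fun (tensorH_mul_tensorqH q) b
    simp only [Module.End.mul_apply, LinearMap.smul_apply, LinearMap.sub_apply] at *
    simp only [tensorY_mul, tensorH_mul, map_add, ha, hb, hb', sub_mul, mul_sub, smul_add,
      smul_mul_assoc, mul_smul_comm]
    abel

/-- The vector `Y^i u^{⊗ k}` of `V_k^q`. -/
def spinVec (q : K) (k i : ℕ) : T K := (tensorY q ^ i) (ι u ^ k)

theorem spinVec_zero (q : K) (k : ℕ) : spinVec q k 0 = ι u ^ k := rfl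

theorem tensorY_spinVec (q : K) (k i : ℕ) :
    tensorY q (spinVec q k i) = spinVec q k (i + 1) := by
  rw [spinVec, spinVec, pow_succ', Module.End.mul_apply]

theorem spinVec_mem_spin (q : K) (k i : ℕ) : spinVec q k i ∈ spin q k :=
  Submodule.subset_span ⟨i, rfl⟩

theorem tensorqH_spinVec (q : K) (hq : q ≠ 0) (k i : ℕ) :
    tensorqH q (spinVec q k i) = (q ^ (2 * k) * (q ^ (2 * i))⁻¹) • spinVec q k i := by
  induction i with
  | zero =>
    have : tensorqH q (ι u ^ k) = (groupLike (actqH q) (ι u)) ^ k :=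
      map_pow (groupLike (actqH q)) _ _
    rw [spinVec_zero, this, groupLike_ι, actqH_u, map_smul, smul_pow]
    simp [pow_mul]
  | succ i ih =>
    have h := LinearMap.congr_fun (tensorqH_mul_tensorY q hq) (spinVec q k i)
    simp only [Module.End.mul_apply, LinearMap.smul_apply, tensorY_spinVec, ih, map_smul,
      smul_smul] at h
    rw [h]
    congr 1
    field_simp
    ring

theorem tensorqH_inv_spinVec (q : K) (hq : q ≠ 0) (k i : ℕ) :
    tensorqH q⁻¹ (spinVec q k i) = ((q ^ (2 * k))⁻¹ * q ^ (2 * i)) • spinVec q k i := by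
  have h := LinearMap.congr_fun (tensorqH_inv_mul q hq) (spinVec q k i)
  simp only [Module.End.mul_apply, tensorqH_spinVec q hq, map_smul, Module.End.one_apply] at h
  conv_rhs => rw [← h, smul_smul]
  rw [show (q ^ (2 * k))⁻¹ * q ^ (2 * i) * (q ^ (2 * k) * (q ^ (2 * i))⁻¹) = 1 by field_simp,
    one_smul]

theorem tensorH_spinVec (q : K) (k i : ℕ) :
    tensorH (spinVec q k i) = (2 * k - 2 * i : K) • spinVec q k i := by
  induction i with
  | zero =>
    rw [spinVec_zero]
    induction k with
    | zero => simp [tensorH_one]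
    | succ k ih =>
      rw [pow_succ', tensorH_mul, ih, tensorH_ι, actH_u, map_smul, smul_mul_assoc, mul_smul_comm]
      push_cast
      module
  | succ i ih =>
    have h := LinearMap.congr_fun (tensorH_mul_tensorY q) (spinVec q k i)
    simp only [Module.End.mul_apply, LinearMap.smul_apply, LinearMap.sub_apply, tensorY_spinVec,
      ih, map_smul] at h
    rw [h]
    push_cast
    module

/-- The coefficient in `X Y^i u^{⊗ k} = [i]_q [2k - i + 1]_q Y^{i-1} u^{⊗ k}`. -/
def raising (q : K) (k i : ℕ) : K :=
  (q ^ i - (q ^ i)⁻¹) * (q ^ (2 * k) * (q ^ i)⁻¹ * q - (q ^ (2 * k))⁻¹ * q ^ i * q⁻¹) *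
    ((q - q⁻¹)⁻¹) ^ 2

theorem raising_zero (q : K) (k : ℕ) : raising q k 0 = 0 := by simp [raising]

theorem raising_ne_zero {q : K} (hq : IsGeneric q) {k i : ℕ} (hi : 0 < i) (hik : i ≤ 2 * k) :
    raising q k i ≠ 0 := by
  have h0 := hq.1
  have hz : q ^ i ≠ 0 := pow_ne_zero _ h0
  have hy : q ^ (2 * k) ≠ 0 := pow_ne_zero _ h0
  refine mul_ne_zero (mul_ne_zero ?_ ?_) (pow_ne_zero _ (inv_ne_zero hq.sub_inv_ne_zero))
  · intro h
    have : q ^ (2 * i) = q ^ 0 := by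
      field_simp at h
      rw [pow_zero, mul_comm, pow_mul]
      linear_combination h
    have := hq.pow_injective this
    omega
  · intro h
    have : q ^ (2 * k + 2 * k + 2) = q ^ (2 * i) := by
      rw [pow_add, pow_add, mul_comm 2 i, pow_mul q i 2]
      generalize q ^ (2 * k) = y at *
      field_simp at h
      linear_combination h
    have := hq.pow_injective this
    omega

theorem tensorX_highest (q : K) (k : ℕ) : tensorX q (ι u ^ k) = 0 := by
  induction k with
  | zero => rw [pow_zero, tensorX_one]
  | succ k ih => simp [pow_succ', tensorX_mul, ih, tensorX_ι, actX_u]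

theorem tensorX_spinVec_succ {q : K} (hq : IsGeneric q) (k i : ℕ) :
    tensorX q (spinVec q k (i + 1)) = raising q k (i + 1) • spinVec q k i := by
  have h0 := hq.1
  have hs := hq.sub_inv_ne_zero
  -- `X Y = Y X + h` turns the claim into the recursion `[i+1][2k-i] = [i][2k-i+1] + [2k-2i]`
  have key : tensorX q (spinVec q k (i + 1)) = tensorY q (tensorX q (spinVec q k i)) +
      ((q - q⁻¹)⁻¹ * (q ^ (2 * k) * (q ^ (2 * i))⁻¹ - (q ^ (2 * k))⁻¹ * q ^ (2 * i))) •
        spinVec q k i := by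
    have h := LinearMap.congr_fun (tensorX_mul_tensorY q hq) (spinVec q k i)
    simp only [Module.End.mul_apply, LinearMap.smul_apply, LinearMap.add_apply,
      LinearMap.sub_apply, tensorY_spinVec, tensorqH_spinVec q h0, tensorqH_inv_spinVec q h0,
      ← sub_smul, smul_smul] at h
    exact h
  have hrec : raising q k (i + 1) = raising q k i +
      (q - q⁻¹)⁻¹ * (q ^ (2 * k) * (q ^ (2 * i))⁻¹ - (q ^ (2 * k))⁻¹ * q ^ (2 * i)) := by
    have hz : q ^ i ≠ 0 := pow_ne_zero _ h0
    have hy : q ^ (2 * k) ≠ 0 := pow_ne_zero _ h0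
    unfold raising
    rw [pow_succ, mul_comm 2 i, pow_mul q i 2]
    generalize q ^ (2 * k) = y at *
    generalize q ^ i = z at *
    have e (a : K) : (q - q⁻¹)⁻¹ * a = (q - q⁻¹)⁻¹ ^ 2 * ((q - q⁻¹) * a) := by
      rw [pow_two, mul_assoc, inv_mul_cancel_left₀ hs]
    rw [e]
    generalize (q - q⁻¹)⁻¹ = s at *
    field_simp
    ring
  rw [key, hrec, add_smul]
  congr 1
  cases i with
  | zero => simp [raising_zero, spinVec_zero, tensorX_highest]
  | succ i => rw [tensorX_spinVec_succ hq k i, map_smul, tensorY_spinVec]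

theorem ι_mul_mem_tensors (x : V K) {k : ℕ} {t : T K} (ht : t ∈ tensors K k) :
    ι x * t ∈ tensors K (k + 1) := by
  rw [tensors, pow_succ']
  exact Submodule.mul_mem_mul ⟨x, rfl⟩ ht

theorem tensors_induction {k : ℕ} {p : T K → Prop}
    (hmul : ∀ (x : V K), ∀ s ∈ tensors K k, p (ι x * s)) (hadd : ∀ s t, p s → p t → p (s + t))
    {t : T K} (ht : t ∈ tensors K (k + 1)) : p t := by
  rw [tensors, pow_succ'] at ht
  refine Submodule.mul_induction_on ht ?_ hadd
  rintro _ ⟨x, rfl⟩ s hs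
  exact hmul x s hs

theorem groupLike_mem_tensors (σ : V K →ₗ[K] V K) {k : ℕ} {t : T K} (ht : t ∈ tensors K k) :
    groupLike σ t ∈ tensors K k := by
  induction k generalizing t with
  | zero =>
    obtain ⟨r, rfl⟩ := Submodule.mem_one.1 (by simpa [tensors] using ht)
    simpa using ht
  | succ k ih =>
    refine tensors_induction (p := fun t => groupLike σ t ∈ tensors K (k + 1))
      (fun x s hs => ?_) (fun s t hs ht => ?_) ht
    · rw [map_mul, groupLike_ι]
      exact ι_mul_mem_tensors _ (ih hs)
    · rw [map_add]
      exact add_mem hs ht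

theorem skew_mem_tensors (σ ρ d : V K →ₗ[K] V K) {k : ℕ} {t : T K} (ht : t ∈ tensors K k) :
    skew σ ρ d t ∈ tensors K k := by
  induction k generalizing t with
  | zero =>
    obtain ⟨r, rfl⟩ := Submodule.mem_one.1 (by simpa [tensors] using ht)
    rw [Algebra.algebraMap_eq_smul_one, map_smul, skew_one, smul_zero]
    exact zero_mem _
  | succ k ih =>
    refine tensors_induction (p := fun t => skew σ ρ d t ∈ tensors K (k + 1))
      (fun x s hs => ?_) (fun s t hs ht => ?_) ht
    · rw [skew_mul, groupLike_ι, skew_ι]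
      exact add_mem (ι_mul_mem_tensors _ (groupLike_mem_tensors ρ hs))
        (ι_mul_mem_tensors _ (ih hs))
    · rw [map_add]
      exact add_mem hs ht

theorem spinVec_mem_tensors (q : K) (k i : ℕ) : spinVec q k i ∈ tensors K k := by
  induction i with
  | zero => exact Submodule.pow_mem_pow _ (LinearMap.mem_range_self ι u) k
  | succ i ih =>
    rw [← tensorY_spinVec]
    exact skew_mem_tensors _ _ _ ih

/-- The part of `T(V)` on which `q^H` acts by `q^(2k - 2i)`. -/
def weightSpace (q : K) (k i : ℕ) : Submodule K (T K) :=
  (tensorqH q).eigenspace (q ^ (2 * k) * (q ^ (2 * i))⁻¹)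

theorem mem_weightSpace {q : K} {k i : ℕ} {t : T K} :
    t ∈ weightSpace q k i ↔ tensorqH q t = (q ^ (2 * k) * (q ^ (2 * i))⁻¹) • t :=
  Module.End.mem_eigenspace_iff

/-- The weights of `V^{⊗ k}` lie between `-2k` and `2k`. -/
theorem tensors_le_iSup_weightSpace {q : K} (hq : q ≠ 0) (k : ℕ) :
    tensors K k ≤ ⨆ i : Fin (2 * k + 1), weightSpace q k i := by
  induction k with
  | zero =>
    intro t ht
    obtain ⟨r, rfl⟩ := Submodule.mem_one.1 (by simpa [tensors] using ht)
    refine Submodule.mem_iSup_of_mem 0 ?_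
    rw [mem_weightSpace, Algebra.algebraMap_eq_smul_one, map_smul, tensorqH_one]
    simp
  | succ k ih =>
    -- multiplication by a weight vector of `V` shifts the weight
    have step (x : V K) (j : ℕ) (hj : j ≤ 2)
        (hx : actqH q x = (q ^ 2 * (q ^ (2 * j))⁻¹) • x) :
        (⨆ i : Fin (2 * k + 1), weightSpace q k i) ≤
          (⨆ i : Fin (2 * (k + 1) + 1), weightSpace q (k + 1) i).comap
            (LinearMap.mulLeft K (ι x)) := by
      refine iSup_le fun i t ht => ?_
      refine Submodule.mem_iSup_of_mem (⟨i + j, by omega⟩ : Fin (2 * (k + 1) + 1)) ?_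
      rw [mem_weightSpace] at ht ⊢
      rw [LinearMap.mulLeft_apply, tensorqH_mul, ht, tensorqH_ι, hx, map_smul, smul_mul_assoc,
        mul_smul_comm, smul_smul]
      congr 1
      simp only [mul_add, pow_add, mul_inv]
      ring
    have hu := step u 0 (by omega) (by simp [actqH_u])
    have hv := step v 1 (by omega) (by simp [actqH_v, hq])
    have hw := step w 2 (by omega) (by
      rw [actqH_w]; congr 1; field_simp)
    intro t ht
    refine tensors_induction (fun x s hs => ?_) (fun s t hs ht => add_mem hs ht) ht
    rw [vec_eq x]
    simp only [map_add, map_smul, add_mul, smul_mul_assoc]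
    exact add_mem (add_mem (Submodule.smul_mem _ _ (hu (ih hs)))
      (Submodule.smul_mem _ _ (hv (ih hs)))) (Submodule.smul_mem _ _ (hw (ih hs)))

theorem IsGeneric.weight_injective {q : K} (hq : IsGeneric q) (k : ℕ) :
    Function.Injective fun i : ℕ => q ^ (2 * k) * (q ^ (2 * i))⁻¹ := by
  intro i j h
  have := hq.pow_injective (inv_injective (mul_left_cancel₀ (pow_ne_zero _ hq.1) h))
  omega

/-- The vector `Y^{2k+1} u^{⊗ k}` vanishes, because its weight does not occur in `V^{⊗ k}`. -/
theorem spinVec_eq_zero {q : K} (hq : IsGeneric q) (k : ℕ) : spinVec q k (2 * k + 1) = 0 := by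
  have hind : iSupIndep (weightSpace q k) :=
    (tensorqH q).eigenspaces_iSupIndep.comp (hq.weight_injective k)
  refine Submodule.disjoint_def.1 (hind (2 * k + 1)) _ ?_ ?_
  · exact mem_weightSpace.2 (tensorqH_spinVec q hq.1 k _)
  · have h := tensors_le_iSup_weightSpace hq.1 k (spinVec_mem_tensors q k (2 * k + 1))
    have hle : ⨆ i : Fin (2 * k + 1), weightSpace q k i ≤
        ⨆ (j : ℕ) (_ : j ≠ 2 * k + 1), weightSpace q k j :=
      iSup_le fun i => le_iSup₂_of_le (f := fun j (_ : j ≠ 2 * k + 1) => weightSpace q k j)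
        (i : ℕ) (by omega) le_rfl
    exact hle h

theorem spinVec_eq_zero_of_lt {q : K} (hq : IsGeneric q) {k i : ℕ} (hi : 2 * k < i) :
    spinVec q k i = 0 := by
  obtain ⟨d, rfl⟩ := Nat.exists_eq_add_of_lt hi
  induction d with
  | zero => exact spinVec_eq_zero hq k
  | succ d ih =>
    rw [← add_assoc, ← tensorY_spinVec, ih (by omega), map_zero]

/-- An operator maps `V_k^q` to `V_k^q` as soon as it does so on the vectors `Y^i u^{⊗ k}`. -/
theorem map_mem_spin {q : K} {k : ℕ} (φ : Module.End K (T K))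
    (h : ∀ i, φ (spinVec q k i) ∈ spin q k) {t : T K} (ht : t ∈ spin q k) : φ t ∈ spin q k := by
  have : spin q k ≤ (spin q k).comap φ := by
    conv_lhs => rw [spin]
    rw [Submodule.span_le]
    rintro _ ⟨i, rfl⟩
    exact h i
  exact this ht

theorem tensorX_mem_spin {q : K} (hq : IsGeneric q) {k : ℕ} {t : T K} (ht : t ∈ spin q k) :
    tensorX q t ∈ spin q k := by
  refine map_mem_spin _ (fun i => ?_) ht
  cases i with
  | zero => rw [spinVec_zero, tensorX_highest]; exact zero_mem _
  | succ i =>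
    rw [tensorX_spinVec_succ hq]
    exact Submodule.smul_mem _ _ (spinVec_mem_spin q k i)

theorem tensorY_mem_spin {q : K} {k : ℕ} {t : T K} (ht : t ∈ spin q k) :
    tensorY q t ∈ spin q k :=
  map_mem_spin _ (fun i => by rw [tensorY_spinVec]; exact spinVec_mem_spin q k _) ht

theorem tensorH_mem_spin {q : K} {k : ℕ} {t : T K} (ht : t ∈ spin q k) :
    tensorH t ∈ spin q k :=
  map_mem_spin _ (fun i => by
    rw [tensorH_spinVec]; exact Submodule.smul_mem _ _ (spinVec_mem_spin q k _)) ht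

theorem tensorqH_mem_spin {q : K} (hq : q ≠ 0) {k : ℕ} {t : T K} (ht : t ∈ spin q k) :
    tensorqH q t ∈ spin q k :=
  map_mem_spin _ (fun i => by
    rw [tensorqH_spinVec q hq]; exact Submodule.smul_mem _ _ (spinVec_mem_spin q k _)) ht

theorem spin_eq_span {q : K} (hq : IsGeneric q) (k : ℕ) :
    spin q k = Submodule.span K (Set.range fun i : Fin (2 * k + 1) => spinVec q k i) := by
  refine le_antisymm (Submodule.span_le.2 ?_) (Submodule.span_le.2 ?_)
  · rintro _ ⟨i, rfl⟩
    by_cases hi : 2 * k < i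
    · change spinVec q k i ∈ _
      rw [spinVec_eq_zero_of_lt hq hi]
      exact zero_mem _
    · exact Submodule.subset_span ⟨⟨i, by omega⟩, rfl⟩
  · rintro _ ⟨i, rfl⟩
    exact spinVec_mem_spin q k i

/-! ### The quantum group acting on the quantum hyperboloid -/

theorem toHyperboloid_surjective (q c : K) : Function.Surjective (toHyperboloid q c) :=
  RingQuot.mkAlgHom_surjective K _

theorem toHyperboloid_ι (q c : K) (x : V K) : toHyperboloid q c (ι x) = gen q c x := rfl

theorem IsGeneric.sq_add_one_ne_zero {q : K} (hq : IsGeneric q) : q ^ 2 + 1 ≠ 0 := by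
  rw [add_comm]
  exact hq.one_add_pow_ne_zero two_pos

section
variable (q c : K)

theorem gen_v_mul_gen_u : gen q c v * gen q c u = q ^ 2 • (gen q c u * gen q c v) := by
  have h := RingQuot.mkAlgHom_rel K (HyperboloidRel.rel_uv (q := q) (c := c))
  change toHyperboloid q c _ = toHyperboloid q c _ at h
  simp only [map_sub, map_smul, map_mul, toHyperboloid_ι, map_zero] at h
  exact (sub_eq_zero.1 h).symm

theorem gen_w_mul_gen_v : gen q c w * gen q c v = q ^ 2 • (gen q c v * gen q c w) := by
  have h := RingQuot.mkAlgHom_rel K (HyperboloidRel.rel_vw (q := q) (c := c))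
  change toHyperboloid q c _ = toHyperboloid q c _ at h
  simp only [map_add, map_neg, map_smul, map_mul, toHyperboloid_ι, map_zero] at h
  exact (neg_add_eq_zero.1 h).symm

theorem gen_u_mul_gen_w_sub :
    (q ^ 3 + q) • (gen q c u * gen q c w - gen q c w * gen q c u) +
      (1 - q ^ 2) • (gen q c v * gen q c v) = 0 := by
  have h := RingQuot.mkAlgHom_rel K (HyperboloidRel.rel_uw (q := q) (c := c))
  change toHyperboloid q c _ = toHyperboloid q c _ at h
  simpa only [map_add, map_sub, map_smul, map_mul, toHyperboloid_ι, map_zero] using h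

theorem gen_casimir :
    (q ^ 3 + q) • (gen q c u * gen q c w) + gen q c v * gen q c v +
      (q + q⁻¹) • (gen q c w * gen q c u) = c • 1 := by
  have h := RingQuot.mkAlgHom_rel K (HyperboloidRel.casimir (q := q) (c := c))
  change toHyperboloid q c _ = toHyperboloid q c _ at h
  simpa only [map_add, map_sub, map_smul, map_mul, toHyperboloid_ι, Algebra.algebraMap_eq_smul_one,
    map_one] using h

end

/-- The last two relations of the quantum hyperboloid, solved for `w u`. -/
theorem gen_w_mul_gen_u {q : K} (hq : IsGeneric q) (c : K) :
    gen q c w * gen q c u =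
      (((q ^ 2 + 1) ^ 2)⁻¹ * q) • (c • 1 - q ^ 2 • (gen q c v * gen q c v)) := by
  have h0 := hq.1
  have hN := hq.sq_add_one_ne_zero
  rw [mul_smul, eq_inv_smul_iff₀ (pow_ne_zero 2 hN), ← gen_casimir, ← sub_eq_zero]
  refine Eq.trans ?_ ((congrArg (fun t => -q • t) (gen_u_mul_gen_w_sub q c)).trans (smul_zero _))
  match_scalars <;> field_simp
  ring

/-- The last two relations of the quantum hyperboloid, solved for `u w`. -/
theorem gen_u_mul_gen_w {q : K} (hq : IsGeneric q) (c : K) :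
    gen q c u * gen q c w =
      (((q ^ 2 + 1) ^ 2)⁻¹ * q) • (c • 1 - (q ^ 2)⁻¹ • (gen q c v * gen q c v)) := by
  have h0 := hq.1
  have hN := hq.sq_add_one_ne_zero
  rw [mul_smul, eq_inv_smul_iff₀ (pow_ne_zero 2 hN), ← gen_casimir, ← sub_eq_zero]
  refine Eq.trans ?_ ((congrArg (fun t => q⁻¹ • t) (gen_u_mul_gen_w_sub q c)).trans
    (smul_zero _))
  match_scalars <;> field_simp <;> ring

theorem groupLike_respects {q : K} (hq : IsGeneric q) (c : K) {p : K} (hp : p ≠ 0) ⦃a b : T K⦄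
    (h : HyperboloidRel q c a b) :
    toHyperboloid q c (groupLike (actqH p) a) = toHyperboloid q c (groupLike (actqH p) b) := by
  have h0 := hq.1
  have hN := hq.sq_add_one_ne_zero
  cases h <;>
    simp only [map_add, map_sub, map_neg, map_smul, map_mul, map_zero, groupLike_ι, actqH_u,
      actqH_v, actqH_w, toHyperboloid_ι, smul_mul_assoc, mul_smul_comm, gen_v_mul_gen_u,
      gen_w_mul_gen_v, gen_u_mul_gen_w hq, gen_w_mul_gen_u hq,
      Algebra.algebraMap_eq_smul_one, map_one] <;>
    match_scalars <;> field_simp <;> ring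

theorem groupLike_id_respects {q : K} (c : K) ⦃a b : T K⦄ (h : HyperboloidRel q c a b) :
    toHyperboloid q c (groupLike LinearMap.id a) =
      toHyperboloid q c (groupLike LinearMap.id b) := by
  rw [groupLike_id, groupLike_id]
  exact RingQuot.mkAlgHom_rel K h

theorem tensorX_respects {q : K} (hq : IsGeneric q) (c : K) ⦃a b : T K⦄
    (h : HyperboloidRel q c a b) :
    toHyperboloid q c (tensorX q a) = toHyperboloid q c (tensorX q b) := by
  have h0 := hq.1
  have hN := hq.sq_add_one_ne_zero
  cases h <;>
    simp only [map_add, map_sub, map_neg, map_smul, map_mul, map_zero, tensorX_mul, tensorX_ι,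
      tensorqH_ι, actqH_u, actX_u, actX_v, actX_w, zero_mul, mul_zero, tensorX_one,
      actqH_v, actqH_w, toHyperboloid_ι, smul_mul_assoc, mul_smul_comm, gen_v_mul_gen_u,
      gen_u_mul_gen_w hq, gen_w_mul_gen_u hq,
      Algebra.algebraMap_eq_smul_one] <;>
    match_scalars <;> field_simp <;> ring

theorem tensorY_respects {q : K} (hq : IsGeneric q) (c : K) ⦃a b : T K⦄
    (h : HyperboloidRel q c a b) :
    toHyperboloid q c (tensorY q a) = toHyperboloid q c (tensorY q b) := by
  have h0 := hq.1
  have hN := hq.sq_add_one_ne_zero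
  cases h <;>
    simp only [map_add, map_sub, map_neg, map_smul, map_mul, map_zero, tensorY_mul, tensorY_ι,
      tensorqH_ι, actqH_u, actY_u, actY_v, actY_w, zero_mul, mul_zero, tensorY_one, neg_mul,
      mul_neg,
      actqH_v, actqH_w, toHyperboloid_ι, smul_mul_assoc, mul_smul_comm, gen_w_mul_gen_v,
      gen_u_mul_gen_w hq, gen_w_mul_gen_u hq,
      Algebra.algebraMap_eq_smul_one] <;>
    match_scalars <;> field_simp <;> ring

theorem tensorH_respects {q : K} (hq : IsGeneric q) (c : K) ⦃a b : T K⦄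
    (h : HyperboloidRel q c a b) :
    toHyperboloid q c (tensorH a) = toHyperboloid q c (tensorH b) := by
  have h0 := hq.1
  have hN := hq.sq_add_one_ne_zero
  cases h <;>
    simp only [map_add, map_sub, map_neg, map_smul, map_mul, map_zero, tensorH_mul, tensorH_ι,
      actH_u, actH_v, actH_w, zero_mul, mul_zero, tensorH_one, toHyperboloid_ι, smul_mul_assoc,
      mul_smul_comm, gen_v_mul_gen_u,
      gen_w_mul_gen_v, gen_u_mul_gen_w hq, gen_w_mul_gen_u hq,
      Algebra.algebraMap_eq_smul_one] <;>
    match_scalars <;> field_simp <;> ring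

/-- The operator `φ` on `T(V)` preserves the kernel of `T(V) → A_{0,q}^c`. -/
def Descends (q c : K) (φ : Module.End K (T K)) : Prop :=
  ∀ t, toHyperboloid q c t = 0 → toHyperboloid q c (φ t) = 0

/-- A skew derivation that is compatible with the defining relations descends to the quantum
hyperboloid: the triangular homomorphism that encodes it factors through the quotient. -/
theorem descends_skew {q c : K} {σ ρ d : V K →ₗ[K] V K}
    (hσ : ∀ ⦃a b⦄, HyperboloidRel q c a b →
      toHyperboloid q c (groupLike σ a) = toHyperboloid q c (groupLike σ b))
    (hρ : ∀ ⦃a b⦄, HyperboloidRel q c a b →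
      toHyperboloid q c (groupLike ρ a) = toHyperboloid q c (groupLike ρ b))
    (hd : ∀ ⦃a b⦄, HyperboloidRel q c a b →
      toHyperboloid q c (skew σ ρ d a) = toHyperboloid q c (skew σ ρ d b)) :
    Descends q c (skew σ ρ d) := by
  let F : T K →ₐ[K] Matrix (Fin 2) (Fin 2) (Hyperboloid q c) :=
    (toHyperboloid q c).mapMatrix.comp (triangular σ ρ d)
  have hF : ∀ ⦃a b⦄, HyperboloidRel q c a b → F a = F b := by
    intro a b h
    have ha := triangular_entries σ ρ d a
    have hb := triangular_entries σ ρ d b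
    ext i j
    change toHyperboloid q c (triangular σ ρ d a i j) = toHyperboloid q c (triangular σ ρ d b i j)
    fin_cases i <;> fin_cases j
    · simpa [ha, hb] using hσ h
    · exact hd h
    · simp [ha, hb]
    · simpa [ha, hb] using hρ h
  intro t ht
  have h := RingQuot.liftAlgHom_mkAlgHom_apply K F hF t
  rw [show RingQuot.mkAlgHom K (HyperboloidRel q c) t = 0 from ht, map_zero] at h
  exact (congrFun (congrFun h 0) 1).symm

theorem descends_groupLike {q c : K} {σ : V K →ₗ[K] V K}
    (hσ : ∀ ⦃a b⦄, HyperboloidRel q c a b →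
      toHyperboloid q c (groupLike σ a) = toHyperboloid q c (groupLike σ b)) :
    Descends q c (groupLike σ).toLinearMap := by
  intro t ht
  have h := RingQuot.liftAlgHom_mkAlgHom_apply K ((toHyperboloid q c).comp (groupLike σ)) hσ t
  rw [show RingQuot.mkAlgHom K (HyperboloidRel q c) t = 0 from ht, map_zero] at h
  exact h.symm

theorem descends_tensorX {q : K} (hq : IsGeneric q) (c : K) : Descends q c (tensorX q) :=
  descends_skew (groupLike_respects hq c (inv_ne_zero hq.1)) (groupLike_id_respects c)
    (tensorX_respects hq c)

theorem descends_tensorY {q : K} (hq : IsGeneric q) (c : K) : Descends q c (tensorY q) :=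
  descends_skew (groupLike_id_respects c) (groupLike_respects hq c hq.1) (tensorY_respects hq c)

theorem descends_tensorH {q : K} (hq : IsGeneric q) (c : K) : Descends q c tensorH :=
  descends_skew (groupLike_id_respects c) (groupLike_id_respects c) (tensorH_respects hq c)

theorem descends_tensorqH {q : K} (hq : IsGeneric q) (c : K) : Descends q c (tensorqH q) :=
  descends_groupLike (groupLike_respects hq c hq.1)

theorem descends_tensorqH_inv {q : K} (hq : IsGeneric q) (c : K) : Descends q c (tensorqH q⁻¹) :=
  descends_groupLike (groupLike_respects hq c (inv_ne_zero hq.1))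

/-- The operator on the quantum hyperboloid induced by an operator `φ` on `T(V)`: apply `φ` to a
linear choice of preimages. It is independent of that choice if `φ` descends. -/
def induced (q c : K) (φ : Module.End K (T K)) : Module.End K (Hyperboloid q c) :=
  (toHyperboloid q c).toLinearMap ∘ₗ φ ∘ₗ
    ((toHyperboloid q c).toLinearMap.exists_rightInverse_of_surjective
      (LinearMap.range_eq_top.2 (toHyperboloid_surjective q c))).choose

theorem induced_toHyperboloid {q c : K} {φ : Module.End K (T K)} (h : Descends q c φ) (t : T K) :
    induced q c φ (toHyperboloid q c t) = toHyperboloid q c (φ t) := by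
  have hs := ((toHyperboloid q c).toLinearMap.exists_rightInverse_of_surjective
      (LinearMap.range_eq_top.2 (toHyperboloid_surjective q c))).choose_spec
  rw [induced, LinearMap.comp_apply, LinearMap.comp_apply]
  generalize Exists.choose _ = s at *
  have := h (s (toHyperboloid q c t) - t) (by
    rw [map_sub, sub_eq_zero]
    exact LinearMap.congr_fun hs (toHyperboloid q c t))
  rw [map_sub, map_sub, sub_eq_zero] at this
  exact this

/-- The action of `X` on the quantum hyperboloid. -/
def hypX (q c : K) : Module.End K (Hyperboloid q c) := induced q c (tensorX q)

/-- The action of `Y` on the quantum hyperboloid. -/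
def hypY (q c : K) : Module.End K (Hyperboloid q c) := induced q c (tensorY q)

/-- The action of `q^H` on the quantum hyperboloid. -/
def hypqH (q c : K) : Module.End K (Hyperboloid q c) := induced q c (tensorqH q)

/-- The action of `q^{-H}` on the quantum hyperboloid. -/
def hypqHInv (q c : K) : Module.End K (Hyperboloid q c) := induced q c (tensorqH q⁻¹)

section action
variable {q : K} (hq : IsGeneric q) (c : K)
include hq

theorem hypX_toHyperboloid (t : T K) :
    hypX q c (toHyperboloid q c t) = toHyperboloid q c (tensorX q t) :=
  induced_toHyperboloid (descends_tensorX hq c) t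

theorem hypY_toHyperboloid (t : T K) :
    hypY q c (toHyperboloid q c t) = toHyperboloid q c (tensorY q t) :=
  induced_toHyperboloid (descends_tensorY hq c) t

theorem hypqH_toHyperboloid (t : T K) :
    hypqH q c (toHyperboloid q c t) = toHyperboloid q c (tensorqH q t) :=
  induced_toHyperboloid (descends_tensorqH hq c) t

theorem hypqHInv_toHyperboloid (t : T K) :
    hypqHInv q c (toHyperboloid q c t) = toHyperboloid q c (tensorqH q⁻¹ t) :=
  induced_toHyperboloid (descends_tensorqH_inv hq c) t

end action

/-! ### The decomposition into spin components -/

/-- The image of `Y^i u^{⊗ k}` in the quantum hyperboloid. -/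
def hypVec (q c : K) (k i : ℕ) : Hyperboloid q c := toHyperboloid q c (spinVec q k i)

/-- The one-dimensional representation `u ↦ 1`, `v ↦ 0` of the quantum hyperboloid shows that
the powers of `u` do not vanish. -/
theorem hypVec_zero_ne_zero {q : K} (hq : IsGeneric q) (c : K) (k : ℕ) : hypVec q c k 0 ≠ 0 := by
  have h0 := hq.1
  have hN := hq.sq_add_one_ne_zero
  let F : T K →ₐ[K] K := TensorAlgebra.lift K
    (LinearMap.proj 0 + (((q ^ 2 + 1) ^ 2)⁻¹ * q * c) • LinearMap.proj 2 : V K →ₗ[K] K)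
  have hu : F (ι u) = 1 := by simp [F, u]
  have hv : F (ι v) = 0 := by simp [F, v]
  have hw : F (ι w) = ((q ^ 2 + 1) ^ 2)⁻¹ * q * c := by simp [F, w]
  have hF : ∀ ⦃a b⦄, HyperboloidRel q c a b → F a = F b := by
    intro a b h
    cases h <;> simp only [map_sub, map_smul, map_mul, hu, hv, hw, map_zero, map_add, map_neg,
      AlgHom.commutes, smul_eq_mul, Algebra.algebraMap_self, RingHom.id_apply] <;> field_simp <;>
      ring
  intro h
  have h1 := RingQuot.liftAlgHom_mkAlgHom_apply K F hF (ι u ^ k)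
  rw [show RingQuot.mkAlgHom K (HyperboloidRel q c) (ι u ^ k) = 0 from h, map_zero, map_pow, hu,
    one_pow] at h1
  exact zero_ne_one h1

section
variable {q : K} (hq : IsGeneric q) (c : K)
include hq

theorem hypX_hypVec_succ (k i : ℕ) :
    hypX q c (hypVec q c k (i + 1)) = raising q k (i + 1) • hypVec q c k i := by
  rw [hypVec, hypX_toHyperboloid hq, tensorX_spinVec_succ hq, map_smul, hypVec]

theorem hypX_hypVec_zero (k : ℕ) : hypX q c (hypVec q c k 0) = 0 := by
  rw [hypVec, hypX_toHyperboloid hq, spinVec_zero, tensorX_highest, map_zero]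

theorem hypY_hypVec (k i : ℕ) : hypY q c (hypVec q c k i) = hypVec q c k (i + 1) := by
  rw [hypVec, hypY_toHyperboloid hq, tensorY_spinVec, hypVec]

theorem hypqH_hypVec (k i : ℕ) :
    hypqH q c (hypVec q c k i) = (q ^ (2 * k) * (q ^ (2 * i))⁻¹) • hypVec q c k i := by
  rw [hypVec, hypqH_toHyperboloid hq, tensorqH_spinVec q hq.1, map_smul]

theorem hypqHInv_hypVec (k i : ℕ) :
    hypqHInv q c (hypVec q c k i) = ((q ^ (2 * k))⁻¹ * q ^ (2 * i)) • hypVec q c k i := by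
  rw [hypVec, hypqHInv_toHyperboloid hq, tensorqH_inv_spinVec q hq.1, map_smul]

theorem hypVec_ne_zero {k i : ℕ} (hi : i ≤ 2 * k) : hypVec q c k i ≠ 0 := by
  induction i with
  | zero => exact hypVec_zero_ne_zero hq c k
  | succ i ih =>
    intro h
    have h1 := hypX_hypVec_succ hq c k i
    rw [h, map_zero] at h1
    exact smul_ne_zero (raising_ne_zero hq (Nat.succ_pos i) hi) (ih (by omega)) h1.symm

/-- Within one spin component, the vectors `Y^i u^k` are told apart by the weight. -/
theorem linearIndependent_hypVec (k : ℕ) :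
    LinearIndependent K fun i : Fin (2 * k + 1) => hypVec q c k i :=
  (hypqH q c).eigenvectors_linearIndependent'
    (fun i : Fin (2 * k + 1) => q ^ (2 * k) * (q ^ (2 * (i : ℕ)))⁻¹)
    ((hq.weight_injective k).comp Fin.val_injective) _ fun i =>
    ⟨Module.End.mem_eigenspace_iff.2 (hypqH_hypVec hq c k i), hypVec_ne_zero hq c (by omega)⟩

end

/-- The Casimir operator `(q - q⁻¹)² Y X + q q^H + q⁻¹ q^{-H}` on the quantum hyperboloid. -/
def casimir (q c : K) : Module.End K (Hyperboloid q c) :=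
  (q - q⁻¹) ^ 2 • (hypY q c * hypX q c) + q • hypqH q c + q⁻¹ • hypqHInv q c

/-- The value of the Casimir operator on the spin `k` component. -/
def casimirValue (q : K) (k : ℕ) : K := q ^ (2 * k) * q + (q ^ (2 * k))⁻¹ * q⁻¹

theorem casimir_hypVec {q : K} (hq : IsGeneric q) (c : K) (k i : ℕ) :
    casimir q c (hypVec q c k i) = casimirValue q k • hypVec q c k i := by
  have h0 := hq.1
  have hYX : hypY q c (hypX q c (hypVec q c k i)) = raising q k i • hypVec q c k i := by
    cases i with
    | zero => rw [hypX_hypVec_zero hq, map_zero, raising_zero, zero_smul]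
    | succ i => rw [hypX_hypVec_succ hq, map_smul, hypY_hypVec hq]
  simp only [casimir, LinearMap.add_apply, LinearMap.smul_apply, Module.End.mul_apply, hYX,
    hypqH_hypVec hq, hypqHInv_hypVec hq, smul_smul, ← add_smul]
  congr 1
  have hs : (q - q⁻¹) ^ 2 * ((q - q⁻¹)⁻¹) ^ 2 = 1 := by
    rw [← mul_pow, mul_inv_cancel₀ hq.sub_inv_ne_zero, one_pow]
  have hz : q ^ i ≠ 0 := pow_ne_zero _ h0
  have hy : q ^ (2 * k) ≠ 0 := pow_ne_zero _ h0
  rw [raising, mul_comm 2 i, pow_mul q i 2, casimirValue, mul_comm _ (_ ^ 2), ← mul_assoc, hs,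
    one_mul]
  generalize q ^ (2 * k) = y at *
  generalize q ^ i = z at *
  field_simp
  ring

theorem casimirValue_injective {q : K} (hq : IsGeneric q) :
    Function.Injective (casimirValue q) := by
  intro k l h
  have h0 := hq.1
  have hk : q ^ (2 * k) ≠ 0 := pow_ne_zero _ h0
  have hl : q ^ (2 * l) ≠ 0 := pow_ne_zero _ h0
  have h1 : (q ^ (2 * k) - q ^ (2 * l)) * (q ^ (2 * k + 2 * l + 2) - q ^ 0) = 0 := by
    unfold casimirValue at h
    rw [pow_add, pow_add, pow_zero]
    generalize q ^ (2 * k) = y at *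
    generalize q ^ (2 * l) = z at *
    field_simp at h
    linear_combination h
  rcases mul_eq_zero.1 h1 with h2 | h2
  · have := hq.pow_injective (sub_eq_zero.1 h2)
    omega
  · have := hq.pow_injective (sub_eq_zero.1 h2)
    omega

theorem casimirValue_ne_zero {q : K} (hq : IsGeneric q) (k : ℕ) : casimirValue q k ≠ 0 := by
  have h0 := hq.1
  intro h
  apply hq.one_add_pow_ne_zero (n := 2 * k + 2 * k + 2) (by omega)
  unfold casimirValue at h
  have hk : q ^ (2 * k) ≠ 0 := pow_ne_zero _ h0
  rw [pow_add, pow_add]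
  generalize q ^ (2 * k) = y at *
  field_simp at h
  linear_combination h

/-- The canonical map from the direct sum of the spin components to the quantum hyperboloid. -/
def fromSpin (q c : K) : DirectSum ℕ (fun k => spin q k) →ₗ[K] Hyperboloid q c :=
  DirectSum.toModule K ℕ (Hyperboloid q c) fun k =>
    (toHyperboloid q c).toLinearMap ∘ₗ (spin q k).subtype

theorem fromSpin_lof (q c : K) (k : ℕ) (t : spin q k) :
    fromSpin q c (DirectSum.lof K ℕ (fun k => spin q k) k t) = toHyperboloid q c t := by
  rw [fromSpin, DirectSum.toModule_lof]; rfl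

theorem casimir_toHyperboloid {q : K} (hq : IsGeneric q) (c : K) {k : ℕ} {t : T K}
    (ht : t ∈ spin q k) :
    casimir q c (toHyperboloid q c t) = casimirValue q k • toHyperboloid q c t := by
  have : spin q k ≤ LinearMap.eqLocus (casimir q c ∘ₗ (toHyperboloid q c).toLinearMap)
      (casimirValue q k • (toHyperboloid q c).toLinearMap) := by
    rw [spin, Submodule.span_le]
    rintro _ ⟨i, rfl⟩
    exact casimir_hypVec hq c k i
  exact this ht

theorem toHyperboloid_injOn_spin {q : K} (hq : IsGeneric q) (c : K) {k : ℕ} {t : T K}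
    (ht : t ∈ spin q k) (h : toHyperboloid q c t = 0) : t = 0 := by
  rw [spin_eq_span hq, Submodule.mem_span_range_iff_exists_fun] at ht
  obtain ⟨a, rfl⟩ := ht
  rw [map_sum] at h
  have := Fintype.linearIndependent_iff.1 (linearIndependent_hypVec hq c k) a
    (by simpa [hypVec] using h)
  simp [this]

theorem iSupIndep_casimir {q : K} (hq : IsGeneric q) (c : K) :
    iSupIndep fun k => (casimir q c).eigenspace (casimirValue q k) :=
  (casimir q c).eigenspaces_iSupIndep.comp (casimirValue_injective hq)

/-- The spin components are linearly independent in the quantum hyperboloid, because the Casimir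
operator takes different values on them. -/
theorem fromSpin_injective {q : K} (hq : IsGeneric q) (c : K) :
    Function.Injective (fromSpin q c) := by
  have hinj := (iSupIndep_casimir hq c).dfinsupp_lsum_injective
  let g (k : ℕ) : spin q k →ₗ[K] (casimir q c).eigenspace (casimirValue q k) :=
    LinearMap.codRestrict _ ((toHyperboloid q c).toLinearMap ∘ₗ (spin q k).subtype) fun t =>
      Module.End.mem_eigenspace_iff.2 (casimir_toHyperboloid hq c t.2)
  have hg (k : ℕ) : Function.Injective (g k) := by
    rw [injective_iff_map_eq_zero]
    intro t ht
    exact Subtype.ext (toHyperboloid_injOn_spin hq c t.2 (congrArg Subtype.val ht))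
  have hcomp : fromSpin q c = (DirectSum.toModule K ℕ (Hyperboloid q c) fun k =>
      ((casimir q c).eigenspace (casimirValue q k)).subtype) ∘ₗ DirectSum.lmap g := by
    refine DirectSum.linearMap_ext K fun k => LinearMap.ext fun t => ?_
    simp [fromSpin, g]
  rw [hcomp]
  rw [LinearMap.coe_comp]
  exact Function.Injective.comp hinj ((DirectSum.lmap_injective g).2 hg)

theorem linearIndependent_hypVec_sigma {q : K} (hq : IsGeneric q) (c : K) (n : ℕ) :
    LinearIndependent K
      fun p : (Σ k : Fin (n + 1), Fin (2 * (k : ℕ) + 1)) => hypVec q c p.1 p.2 := by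
  refine linearIndependent_iUnion_finite (f := fun (k : Fin (n + 1)) (i : Fin (2 * (k : ℕ) + 1)) =>
    hypVec q c k i) (fun k => linearIndependent_hypVec hq c k) fun k s _ hk => ?_
  have hle (l : Fin (n + 1)) : Submodule.span K (Set.range fun i : Fin (2 * (l : ℕ) + 1) =>
      hypVec q c l i) ≤ (casimir q c).eigenspace (casimirValue q l) := by
    rw [Submodule.span_le]
    rintro _ ⟨i, rfl⟩
    exact Module.End.mem_eigenspace_iff.2 (casimir_hypVec hq c l i)
  exact (((iSupIndep_casimir hq c).comp Fin.val_injective).disjoint_biSup hk).mono (hle k)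
    (iSup₂_mono fun l _ => hle l)

/-- The ordered monomials `u^{k-i} v^i` (for `i ≤ k`) and `v^{2k-i} w^{i-k}` (for `k ≤ i ≤ 2k`):
there is one of degree `k` for each vector `Y^i u^{⊗ k}`. -/
def monomial (q c : K) (k i : ℕ) : Hyperboloid q c :=
  if i ≤ k then gen q c u ^ (k - i) * gen q c v ^ i
  else gen q c v ^ (2 * k - i) * gen q c w ^ (i - k)

/-- The span of the ordered monomials of degree at most `n`. -/
def monomialSpan (q c : K) (n : ℕ) : Submodule K (Hyperboloid q c) :=
  Submodule.span K (Set.range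
    fun p : (Σ k : Fin (n + 1), Fin (2 * (k : ℕ) + 1)) => monomial q c p.1 p.2)

theorem u_pow_mul_v_pow_mem {q c : K} {i j n : ℕ} (h : i + j ≤ n) :
    gen q c u ^ i * gen q c v ^ j ∈ monomialSpan q c n := by
  refine Submodule.subset_span ⟨⟨⟨i + j, by omega⟩, ⟨j, ?_⟩⟩, ?_⟩
  · change j < 2 * (i + j) + 1
    omega
  · change monomial q c (i + j) j = _
    rw [monomial, if_pos (by omega), Nat.add_sub_cancel]

theorem v_pow_mul_w_pow_mem {q c : K} {i j n : ℕ} (h : i + j ≤ n) :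
    gen q c v ^ i * gen q c w ^ j ∈ monomialSpan q c n := by
  rcases Nat.eq_zero_or_pos j with rfl | hj
  · simpa using u_pow_mul_v_pow_mem (q := q) (c := c) (i := 0) (j := i) (n := n) (by omega)
  · refine Submodule.subset_span ⟨⟨⟨i + j, by omega⟩, ⟨i + 2 * j, ?_⟩⟩, ?_⟩
    · change i + 2 * j < 2 * (i + j) + 1
      omega
    · change monomial q c (i + j) (i + 2 * j) = _
      rw [monomial, if_neg (by omega)]
      congr 2 <;> omega

theorem pow_mul_comm_smul {R : Type*} [Ring R] [Algebra K R] {x y : R} {a : K}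
    (h : x * y = a • (y * x)) (n : ℕ) : x * y ^ n = a ^ n • (y ^ n * x) := by
  induction n with
  | zero => simp
  | succ n ih =>
    rw [pow_succ, ← mul_assoc, ih, smul_mul_assoc, mul_assoc, h, mul_smul_comm, smul_smul,
      ← mul_assoc, ← pow_succ]

/-- Left multiplication by a generator raises the degree of the ordered monomials by at most
one. -/
theorem gen_mul_mem_monomialSpan {q : K} (hq : IsGeneric q) (c : K) (x : V K) {n : ℕ}
    {a : Hyperboloid q c} (ha : a ∈ monomialSpan q c n) :
    gen q c x * a ∈ monomialSpan q c (n + 1) := by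
  have h0 := hq.1
  have hv : gen q c u * gen q c v = (q ^ 2)⁻¹ • (gen q c v * gen q c u) := by
    rw [gen_v_mul_gen_u, smul_smul, inv_mul_cancel₀ (pow_ne_zero 2 h0), one_smul]
  have hu' := pow_mul_comm_smul hv
  have hv' := pow_mul_comm_smul (gen_v_mul_gen_u q c)
  have hw' := pow_mul_comm_smul (gen_w_mul_gen_v q c)
  have key : monomialSpan q c n ≤ (monomialSpan q c (n + 1)).comap (LinearMap.mulLeft K (gen q c x))
    := by
    conv_lhs => rw [monomialSpan]
    rw [Submodule.span_le]
    rintro _ ⟨⟨⟨k, hk⟩, ⟨i, hi⟩⟩, rfl⟩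
    change gen q c x * monomial q c k i ∈ monomialSpan q c (n + 1)
    change i < 2 * k + 1 at hi
    have hu : gen q c u * monomial q c k i ∈ monomialSpan q c (n + 1) := by
      rw [monomial]
      split_ifs with h
      · rw [← mul_assoc, ← pow_succ']
        exact u_pow_mul_v_pow_mem (by omega)
      · obtain ⟨j, rfl⟩ : ∃ j, i = k + j + 1 := ⟨i - k - 1, by omega⟩
        rw [← mul_assoc, hu', smul_mul_assoc, mul_assoc, show k + j + 1 - k = j + 1 by omega,
          pow_succ' (gen q c w), ← mul_assoc (gen q c u), gen_u_mul_gen_w hq]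
        refine Submodule.smul_mem _ _ ?_
        rw [smul_mul_assoc, mul_smul_comm, sub_mul, mul_sub]
        refine Submodule.smul_mem _ _ (sub_mem ?_ ?_)
        · rw [smul_mul_assoc, mul_smul_comm, one_mul]
          exact Submodule.smul_mem _ _ (v_pow_mul_w_pow_mem (by omega))
        · rw [smul_mul_assoc, mul_smul_comm, ← mul_assoc, ← mul_assoc, ← pow_succ, ← pow_succ]
          exact Submodule.smul_mem _ _ (v_pow_mul_w_pow_mem (by omega))
    have hv : gen q c v * monomial q c k i ∈ monomialSpan q c (n + 1) := by
      rw [monomial]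
      split_ifs with h
      · rw [← mul_assoc, hv', smul_mul_assoc, mul_assoc, ← pow_succ']
        exact Submodule.smul_mem _ _ (u_pow_mul_v_pow_mem (by omega))
      · rw [← mul_assoc, ← pow_succ']
        exact v_pow_mul_w_pow_mem (by omega)
    have hw : gen q c w * monomial q c k i ∈ monomialSpan q c (n + 1) := by
      rw [monomial]
      split_ifs with h
      · rcases Nat.eq_zero_or_pos (k - i) with h1 | h1
        · rw [h1, pow_zero, one_mul, hw']
          refine Submodule.smul_mem _ _ ?_
          simpa using v_pow_mul_w_pow_mem (q := q) (c := c) (i := i) (j := 1) (n := n + 1)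
            (by omega)
        · obtain ⟨j, hj⟩ : ∃ j, k - i = j + 1 := ⟨k - i - 1, by omega⟩
          have hvv : gen q c v * gen q c v * gen q c u ^ j =
              ((q ^ 2) ^ j * (q ^ 2) ^ j) • (gen q c u ^ j * (gen q c v * gen q c v)) := by
            rw [mul_assoc, hv', mul_smul_comm, ← mul_assoc, hv', smul_mul_assoc, smul_smul,
              mul_assoc]
          rw [hj, pow_succ', ← mul_assoc, ← mul_assoc, gen_w_mul_gen_u hq, smul_mul_assoc,
            smul_mul_assoc, sub_mul, sub_mul]
          refine Submodule.smul_mem _ _ (sub_mem ?_ ?_)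
          · rw [smul_mul_assoc, smul_mul_assoc, one_mul]
            exact Submodule.smul_mem _ _ (u_pow_mul_v_pow_mem (by omega))
          · rw [smul_mul_assoc, smul_mul_assoc, hvv, smul_mul_assoc, mul_assoc, mul_assoc,
              ← pow_succ', ← pow_succ']
            exact Submodule.smul_mem _ _ (Submodule.smul_mem _ _ (u_pow_mul_v_pow_mem (by omega)))
      · rw [← mul_assoc, hw', smul_mul_assoc, mul_assoc, ← pow_succ']
        exact Submodule.smul_mem _ _ (v_pow_mul_w_pow_mem (by omega))
    rw [vec_eq x]
    simp only [map_add, map_smul, add_mul, smul_mul_assoc]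
    exact add_mem (add_mem (Submodule.smul_mem _ _ hu) (Submodule.smul_mem _ _ hv))
      (Submodule.smul_mem _ _ hw)
  exact key ha

theorem monomialSpan_mono (q c : K) : Monotone (monomialSpan q c) := by
  intro m n hmn
  conv_lhs => rw [monomialSpan]
  rw [Submodule.span_le]
  rintro _ ⟨⟨⟨k, hk⟩, i⟩, rfl⟩
  exact Submodule.subset_span ⟨⟨⟨k, by omega⟩, i⟩, rfl⟩

theorem toHyperboloid_mem_monomialSpan {q : K} (hq : IsGeneric q) (c : K) {k : ℕ} {t : T K}
    (ht : t ∈ tensors K k) : toHyperboloid q c t ∈ monomialSpan q c k := by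
  induction k generalizing t with
  | zero =>
    obtain ⟨r, rfl⟩ := Submodule.mem_one.1 (by simpa [tensors] using ht)
    rw [AlgHom.commutes, Algebra.algebraMap_eq_smul_one]
    refine Submodule.smul_mem _ _ ?_
    simpa using u_pow_mul_v_pow_mem (q := q) (c := c) (i := 0) (j := 0) (n := 0) le_rfl
  | succ k ih =>
    refine tensors_induction (p := fun t => toHyperboloid q c t ∈ monomialSpan q c (k + 1))
      (fun x s hs => ?_) (fun s t hs ht => ?_) ht
    · rw [map_mul]
      exact gen_mul_mem_monomialSpan hq c x (ih hs)
    · rw [map_add]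
      exact add_mem hs ht

theorem exists_mem_monomialSpan {q : K} (hq : IsGeneric q) (c : K) (a : Hyperboloid q c) :
    ∃ n, a ∈ monomialSpan q c n := by
  obtain ⟨t, rfl⟩ := toHyperboloid_surjective q c a
  -- the union of the spans is stable under left multiplication, and it contains `1`
  suffices h : ∀ n, ∀ b ∈ monomialSpan q c n, ∃ m, toHyperboloid q c t * b ∈ monomialSpan q c m by
    have h1 : (1 : Hyperboloid q c) ∈ monomialSpan q c 0 := by
      simpa using u_pow_mul_v_pow_mem (q := q) (c := c) (i := 0) (j := 0) (n := 0) le_rfl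
    simpa using h 0 1 h1
  induction t using TensorAlgebra.induction with
  | algebraMap r =>
    intro n b hb
    refine ⟨n, ?_⟩
    rw [AlgHom.commutes, ← Algebra.smul_def]
    exact Submodule.smul_mem _ _ hb
  | ι x => exact fun n b hb => ⟨n + 1, gen_mul_mem_monomialSpan hq c x hb⟩
  | mul s t hs ht =>
    intro n b hb
    obtain ⟨m, hm⟩ := ht n b hb
    rw [map_mul, mul_assoc]
    exact hs m _ hm
  | add s t hs ht =>
    intro n b hb
    obtain ⟨l, hl⟩ := hs n b hb
    obtain ⟨m, hm⟩ := ht n b hb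
    rw [map_add, add_mul]
    exact ⟨max l m, add_mem (monomialSpan_mono q c (le_max_left l m) hl)
      (monomialSpan_mono q c (le_max_right l m) hm)⟩

/-- The span of the ordered monomials of degree at most `n` is the sum of the spin components
`k ≤ n`: it contains these components, and their total dimension is at least the number of
monomials. -/
theorem monomialSpan_eq {q : K} (hq : IsGeneric q) (c : K) (n : ℕ) :
    Submodule.span K (Set.range
      fun p : (Σ k : Fin (n + 1), Fin (2 * (k : ℕ) + 1)) => hypVec q c p.1 p.2) =
    monomialSpan q c n := by
  have : FiniteDimensional K (monomialSpan q c n) :=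
    FiniteDimensional.span_of_finite K (Set.finite_range _)
  refine Submodule.eq_of_le_of_finrank_le ?_ ?_
  · rw [Submodule.span_le]
    rintro _ ⟨⟨⟨k, hk⟩, i⟩, rfl⟩
    exact monomialSpan_mono q c (Nat.le_of_lt_succ hk)
      (toHyperboloid_mem_monomialSpan hq c (spinVec_mem_tensors q k i))
  · rw [finrank_span_eq_card (linearIndependent_hypVec_sigma hq c n)]
    exact finrank_range_le_card _

theorem fromSpin_surjective {q : K} (hq : IsGeneric q) (c : K) :
    Function.Surjective (fromSpin q c) := by
  intro a
  obtain ⟨n, hn⟩ := exists_mem_monomialSpan hq c a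
  rw [← monomialSpan_eq hq] at hn
  change a ∈ LinearMap.range (fromSpin q c)
  refine Submodule.span_le.2 ?_ hn
  rintro _ ⟨⟨k, i⟩, rfl⟩
  exact ⟨_, fromSpin_lof q c k ⟨_, spinVec_mem_spin q k i⟩⟩

/-! ### Spin projections and the inverse of the Casimir operator -/

theorem fromSpin_bijective {q : K} (hq : IsGeneric q) (c : K) :
    Function.Bijective (fromSpin q c) :=
  ⟨fromSpin_injective hq c, fromSpin_surjective hq c⟩

theorem hyperboloid_hom_ext {q c : K} {M : Type*} [AddCommGroup M] [Module K M]
    {f g : Hyperboloid q c →ₗ[K] M}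
    (h : ∀ t, f (toHyperboloid q c t) = g (toHyperboloid q c t)) : f = g := by
  refine LinearMap.ext fun a => ?_
  obtain ⟨t, rfl⟩ := toHyperboloid_surjective q c a
  exact h t

/-- A linear map on the quantum hyperboloid is determined by its values on the vectors
`Y^i u^k`. -/
theorem hyperboloid_hom_ext_hypVec {q : K} (hq : IsGeneric q) {c : K} {M : Type*}
    [AddCommGroup M] [Module K M] {f g : Hyperboloid q c →ₗ[K] M}
    (h : ∀ k i, f (hypVec q c k i) = g (hypVec q c k i)) : f = g := by
  refine LinearMap.ext fun a => ?_
  obtain ⟨s, rfl⟩ := fromSpin_surjective hq c a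
  induction s using DirectSum.induction_on with
  | zero => simp only [map_zero]
  | of k t =>
    rw [← DirectSum.lof_eq_of K, fromSpin_lof]
    have : spin q k ≤ LinearMap.eqLocus (f ∘ₗ (toHyperboloid q c).toLinearMap)
        (g ∘ₗ (toHyperboloid q c).toLinearMap) := by
      rw [spin, Submodule.span_le]
      rintro _ ⟨i, rfl⟩
      exact h k i
    exact this t.2
  | add s t hs ht => rw [map_add, map_add, map_add, hs, ht]

/-- The component in `V_k^q ⊆ V^{⊗ k}` of an element of the quantum hyperboloid. -/
def spinComponent {q : K} (hq : IsGeneric q) (c : K) (k : ℕ) : Hyperboloid q c →ₗ[K] T K :=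
  (spin q k).subtype ∘ₗ DirectSum.component K ℕ (fun k => spin q k) k ∘ₗ
    (LinearEquiv.ofBijective (fromSpin q c) (fromSpin_bijective hq c)).symm.toLinearMap

section
variable {q : K} (hq : IsGeneric q) (c : K)

theorem fromSpin_symm_toHyperboloid {k : ℕ} {t : T K} (ht : t ∈ spin q k) :
    (LinearEquiv.ofBijective (fromSpin q c) (fromSpin_bijective hq c)).symm
      (toHyperboloid q c t) = DirectSum.lof K ℕ (fun k => spin q k) k ⟨t, ht⟩ := by
  rw [LinearEquiv.symm_apply_eq, LinearEquiv.ofBijective_apply, fromSpin_lof]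

theorem spinComponent_toHyperboloid {k : ℕ} {t : T K} (ht : t ∈ spin q k) :
    spinComponent hq c k (toHyperboloid q c t) = t := by
  simp only [spinComponent, LinearMap.comp_apply, LinearEquiv.coe_coe,
    fromSpin_symm_toHyperboloid hq c ht, DirectSum.component.lof_self, Submodule.subtype_apply]

theorem spinComponent_toHyperboloid_of_ne {j k : ℕ} (hjk : j ≠ k) {t : T K}
    (ht : t ∈ spin q j) : spinComponent hq c k (toHyperboloid q c t) = 0 := by
  simp only [spinComponent, LinearMap.comp_apply, LinearEquiv.coe_coe,
    fromSpin_symm_toHyperboloid hq c ht, DirectSum.component.of, dif_neg hjk, map_zero]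

theorem spinComponent_mem (k : ℕ) (a : Hyperboloid q c) : spinComponent hq c k a ∈ spin q k :=
  Subtype.coe_prop _

/-- Taking the spin `k` component commutes with every operator that preserves the spin
components. -/
theorem spinComponent_induced {φ : Module.End K (T K)} (hφ : Descends q c φ)
    (hs : ∀ k, ∀ t ∈ spin q k, φ t ∈ spin q k) (k : ℕ) (a : Hyperboloid q c) :
    spinComponent hq c k (induced q c φ a) = φ (spinComponent hq c k a) := by
  have : spinComponent hq c k ∘ₗ induced q c φ = φ ∘ₗ spinComponent hq c k := by
    refine hyperboloid_hom_ext_hypVec hq fun j i => ?_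
    have hj := spinVec_mem_spin q j i
    rw [LinearMap.comp_apply, LinearMap.comp_apply, hypVec, induced_toHyperboloid hφ]
    rcases eq_or_ne j k with rfl | hjk
    · rw [spinComponent_toHyperboloid hq c hj, spinComponent_toHyperboloid hq c (hs _ _ hj)]
    · rw [spinComponent_toHyperboloid_of_ne hq c hjk hj,
        spinComponent_toHyperboloid_of_ne hq c hjk (hs _ _ hj), map_zero]
  exact LinearMap.congr_fun this a

/-- The projection `V^{⊗ k} → V_k^q`: multiply out in the quantum hyperboloid, and take the
spin `k` component of the result. -/
def spinProj (k : ℕ) : Module.End K (T K) :=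
  spinComponent hq c k ∘ₗ (toHyperboloid q c).toLinearMap

theorem spinProj_apply (k : ℕ) (t : T K) :
    spinProj hq c k t = spinComponent hq c k (toHyperboloid q c t) := rfl

theorem spinProj_of_mem {k : ℕ} {t : T K} (ht : t ∈ spin q k) : spinProj hq c k t = t :=
  spinComponent_toHyperboloid hq c ht

theorem spinProj_comm {φ : Module.End K (T K)} (hφ : Descends q c φ)
    (hs : ∀ k, ∀ t ∈ spin q k, φ t ∈ spin q k) (k : ℕ) (t : T K) :
    spinProj hq c k (φ t) = φ (spinProj hq c k t) := by
  rw [spinProj_apply, spinProj_apply, ← induced_toHyperboloid hφ,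
    spinComponent_induced hq c hφ hs]

theorem isBraidedProjector_spinProj (k : ℕ) : IsBraidedProjector q k (spinProj hq c k) where
  mem_spin _ _ := spinComponent_mem hq c k _
  eq_self _ ht := spinProj_of_mem hq c ht
  comm_X t _ := spinProj_comm hq c (descends_tensorX hq c) (fun _ _ => tensorX_mem_spin hq) k t
  comm_Y t _ := spinProj_comm hq c (descends_tensorY hq c) (fun _ _ => tensorY_mem_spin) k t
  comm_H t _ := spinProj_comm hq c (descends_tensorH hq c) (fun _ _ => tensorH_mem_spin) k t
  comm_qH t _ :=
    spinProj_comm hq c (descends_tensorqH hq c) (fun _ _ => tensorqH_mem_spin hq.1) k t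

/-- The inverse of the Casimir operator. -/
def casimirInv : Module.End K (Hyperboloid q c) :=
  (DirectSum.toModule K ℕ (Hyperboloid q c) fun k =>
    (casimirValue q k)⁻¹ • ((toHyperboloid q c).toLinearMap ∘ₗ (spin q k).subtype)) ∘ₗ
    (LinearEquiv.ofBijective (fromSpin q c) (fromSpin_bijective hq c)).symm.toLinearMap

theorem casimirInv_toHyperboloid {k : ℕ} {t : T K} (ht : t ∈ spin q k) :
    casimirInv hq c (toHyperboloid q c t) = (casimirValue q k)⁻¹ • toHyperboloid q c t := by
  simp only [casimirInv, LinearMap.comp_apply, LinearEquiv.coe_coe,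
    fromSpin_symm_toHyperboloid hq c ht, DirectSum.toModule_lof, LinearMap.smul_apply,
    Submodule.subtype_apply, AlgHom.toLinearMap_apply]

theorem casimirInv_hypVec (k i : ℕ) :
    casimirInv hq c (hypVec q c k i) = (casimirValue q k)⁻¹ • hypVec q c k i :=
  casimirInv_toHyperboloid hq c (spinVec_mem_spin q k i)

theorem casimirInv_mul_casimir : casimirInv hq c * casimir q c = 1 := by
  refine hyperboloid_hom_ext_hypVec hq fun k i => ?_
  rw [Module.End.mul_apply, casimir_hypVec hq, map_smul, casimirInv_hypVec, smul_smul,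
    mul_inv_cancel₀ (casimirValue_ne_zero hq k), one_smul, Module.End.one_apply]

theorem commute_casimirInv_induced {φ : Module.End K (T K)} (hφ : Descends q c φ)
    (hs : ∀ k, ∀ t ∈ spin q k, φ t ∈ spin q k) :
    Commute (casimirInv hq c) (induced q c φ) := by
  refine hyperboloid_hom_ext_hypVec hq fun k i => ?_
  have hk := spinVec_mem_spin q k i
  rw [Module.End.mul_apply, Module.End.mul_apply, casimirInv_hypVec, hypVec, map_smul,
    induced_toHyperboloid hφ, casimirInv_toHyperboloid hq c (hs _ _ hk)]

theorem commute_casimirInv_hypX : Commute (casimirInv hq c) (hypX q c) :=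
  commute_casimirInv_induced hq c (descends_tensorX hq c) fun _ _ => tensorX_mem_spin hq

theorem commute_casimirInv_hypY : Commute (casimirInv hq c) (hypY q c) :=
  commute_casimirInv_induced hq c (descends_tensorY hq c) fun _ _ => tensorY_mem_spin

theorem commute_casimirInv_hypqH : Commute (casimirInv hq c) (hypqH q c) :=
  commute_casimirInv_induced hq c (descends_tensorqH hq c) fun _ _ => tensorqH_mem_spin hq.1

end

/-! ### The copy of `V` in the quantum group -/

/-- The elements `X q^H`, `q⁻² X Y - Y X`, `q⁻² Y` span a copy of `V` in the quantum group under
the adjoint action. This is the resulting map from `V`, for operators `X`, `Y`, `k = q^H` in an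
arbitrary algebra. -/
def adjointVec {R : Type*} [Ring R] [Algebra K R] (q : K) (X Y k : R) : V K →ₗ[K] R :=
  (LinearMap.proj 0).smulRight (X * k) +
    (LinearMap.proj 1).smulRight ((q ^ 2)⁻¹ • (X * Y) - Y * X) +
    (LinearMap.proj 2).smulRight ((q ^ 2)⁻¹ • Y)

section
variable {R : Type*} [Ring R] [Algebra K R]

theorem adjointVec_u (q : K) (X Y k : R) : adjointVec q X Y k u = X * k := by
  simp [adjointVec, u]

theorem adjointVec_v (q : K) (X Y k : R) :
    adjointVec q X Y k v = (q ^ 2)⁻¹ • (X * Y) - Y * X := by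
  simp [adjointVec, v]

theorem adjointVec_w (q : K) (X Y k : R) : adjointVec q X Y k w = (q ^ 2)⁻¹ • Y := by
  simp [adjointVec, w]

/-- The defining relations of the quantum group, for elements `X`, `Y`, `k = q^H`, `k' = q^{-H}`
of an algebra. -/
structure QuantumRel (q : K) (X Y k k' : R) : Prop where
  k_X : k * X = q ^ 2 • (X * k)
  k_Y : k * Y = (q ^ 2)⁻¹ • (Y * k)
  k'_X : k' * X = (q ^ 2)⁻¹ • (X * k')
  k'_Y : k' * Y = q ^ 2 • (Y * k')
  k_k' : k * k' = 1
  k'_k : k' * k = 1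
  X_Y : X * Y = Y * X + (q - q⁻¹)⁻¹ • (k - k')

namespace QuantumRel
variable {q : K} {X Y k k' : R}

theorem X_Y_mul (h : QuantumRel q X Y k k') (a : R) :
    X * (Y * a) = Y * (X * a) + (q - q⁻¹)⁻¹ • (k * a - k' * a) := by
  rw [← mul_assoc, h.X_Y, add_mul, smul_mul_assoc, sub_mul, mul_assoc]

theorem mul_of_smul {x y : R} {b : K} (h : x * y = b • (y * x)) (a : R) :
    x * (y * a) = b • (y * (x * a)) := by
  rw [← mul_assoc, h, smul_mul_assoc, mul_assoc]

theorem Y_mul_adjointVec (h : QuantumRel q X Y k k') (hq : IsGeneric q) (x : V K) :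
    Y * adjointVec q X Y k x =
      adjointVec q X Y k x * Y + adjointVec q X Y k (actY q x) * k := by
  have h0 := hq.1
  have hs : q ^ 2 - 1 ≠ 0 := sub_ne_zero.2 (hq.2 2 two_pos)
  have : LinearMap.mulLeft K Y ∘ₗ adjointVec q X Y k = LinearMap.mulRight K Y ∘ₗ
      adjointVec q X Y k + LinearMap.mulRight K k ∘ₗ adjointVec q X Y k ∘ₗ actY q := by
    apply hom_ext_basis <;>
    simp only [LinearMap.comp_apply, LinearMap.add_apply, LinearMap.mulLeft_apply,
      LinearMap.mulRight_apply, actY_u, actY_v, actY_w, map_neg, map_smul, map_zero,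
      adjointVec_u, adjointVec_v, adjointVec_w, mul_assoc, mul_sub, sub_mul, mul_add, add_mul,
      smul_mul_assoc, mul_smul_comm, h.X_Y, h.X_Y_mul, h.k_Y, h.k'_Y, h.k'_k] <;>
    match_scalars <;> field_simp <;> ring
  exact LinearMap.congr_fun this x

theorem k_mul_adjointVec (h : QuantumRel q X Y k k') (hq : IsGeneric q) (x : V K) :
    k * adjointVec q X Y k x = adjointVec q X Y k (actqH q x) * k := by
  have h0 := hq.1
  have : LinearMap.mulLeft K k ∘ₗ adjointVec q X Y k =
      LinearMap.mulRight K k ∘ₗ adjointVec q X Y k ∘ₗ actqH q := by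
    apply hom_ext_basis <;>
    simp only [LinearMap.comp_apply, LinearMap.mulLeft_apply,
      LinearMap.mulRight_apply, actqH_u, actqH_v, actqH_w, map_smul,
      adjointVec_u, adjointVec_v, adjointVec_w, mul_assoc, mul_sub, sub_mul,
      smul_mul_assoc, mul_smul_comm, h.k_Y, h.k_X,
      mul_of_smul h.k_Y, mul_of_smul h.k_X] <;>
    match_scalars <;> field_simp
  exact LinearMap.congr_fun this x

/-- The quadratic relations between the elements `adjointVec`: their `q`-antisymmetric products
are, up to sign, the Casimir element times these elements. -/
theorem adjointVec_relations (h : QuantumRel q X Y k k') (hq : IsGeneric q) {C : R}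
    (hC : C = (q - q⁻¹) ^ 2 • (Y * X) + q • k + q⁻¹ • k') :
    q ^ 2 • (adjointVec q X Y k u * adjointVec q X Y k v) -
        adjointVec q X Y k v * adjointVec q X Y k u = -(C * adjointVec q X Y k u) ∧
    (q ^ 3 + q) • (adjointVec q X Y k u * adjointVec q X Y k w -
        adjointVec q X Y k w * adjointVec q X Y k u) +
        (1 - q ^ 2) • (adjointVec q X Y k v * adjointVec q X Y k v) =
      C * adjointVec q X Y k v ∧
    -(q ^ 2 • (adjointVec q X Y k v * adjointVec q X Y k w)) +
        adjointVec q X Y k w * adjointVec q X Y k v = C * adjointVec q X Y k w := by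
  have h0 := hq.1
  have hs : q ^ 2 - 1 ≠ 0 := sub_ne_zero.2 (hq.2 2 two_pos)
  subst hC
  refine ⟨?_, ?_, ?_⟩ <;>
    simp only [adjointVec_u, adjointVec_v, adjointVec_w, mul_assoc, mul_sub, sub_mul, mul_add,
      add_mul, smul_mul_assoc, mul_smul_comm, h.X_Y, h.X_Y_mul, h.k_X, h.k_Y, h.k'_X, h.k'_Y,
      h.k_k', h.k'_k, mul_of_smul h.k_X, mul_of_smul h.k_Y, mul_of_smul h.k'_X,
      mul_of_smul h.k'_Y, smul_add, smul_sub, smul_smul] <;>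
    match_scalars <;> field_simp <;> ring

theorem commute_adjointVec {Z : R} (hX : Commute Z X) (hY : Commute Z Y) (hk : Commute Z k)
    (x : V K) : Commute Z (adjointVec q X Y k x) := by
  rw [vec_eq x]
  simp only [map_add, map_smul, adjointVec_u, adjointVec_v, adjointVec_w]
  exact (((hX.mul_right hk).smul_right _).add_right ((((hX.mul_right hY).smul_right _).sub_right
    (hY.mul_right hX)).smul_right _)).add_right ((hY.smul_right _).smul_right _)

/-- Division by the Casimir element turns the quadratic relations of `adjointVec` into the
quadratic-linear relations of the braided enveloping algebra. -/
theorem rescaled_relations (h : QuantumRel q X Y k k') (hq : IsGeneric q) {C Z : R}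
    (hC : C = (q - q⁻¹) ^ 2 • (Y * X) + q • k + q⁻¹ • k') (hZC : Z * C = 1)
    (hZ : ∀ x, Commute Z (adjointVec q X Y k x)) (a b : K) {D : V K → R}
    (hD : ∀ x, D x = (a * b) • (Z * adjointVec q X Y k x)) :
    q ^ 2 • (D u * D v) - D v * D u = a • -b • D u ∧
    (q ^ 3 + q) • (D u * D w - D w * D u) + (1 - q ^ 2) • (D v * D v) = a • b • D v ∧
    -(q ^ 2 • (D v * D w)) + D w * D v = a • b • D w := by
  obtain ⟨r1, r2, r3⟩ := h.adjointVec_relations hq hC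
  have hDD (x y : V K) : D x * D y =
      (a * b) ^ 2 • (Z * (Z * (adjointVec q X Y k x * adjointVec q X Y k y))) := by
    rw [hD, hD, smul_mul_smul_comm, pow_two, mul_assoc Z, ← mul_assoc _ Z, ← (hZ x).eq,
      mul_assoc Z]
  have hCan (r : R) : Z * (C * r) = r := by rw [← mul_assoc, hZC, one_mul]
  simp only [hDD]
  simp only [hD]
  refine ⟨?_, ?_, ?_⟩
  · have e := congrArg (fun r => (a * b) ^ 2 • (Z * (Z * r))) r1
    simp only [mul_sub, mul_neg, hCan, mul_smul_comm, smul_sub] at e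
    rw [smul_comm, e]
    module
  · have e := congrArg (fun r => (a * b) ^ 2 • (Z * (Z * r))) r2
    simp only [mul_sub, mul_add, hCan, mul_smul_comm, smul_sub, smul_add] at e
    rw [smul_sub, smul_comm _ ((a * b) ^ 2), smul_comm _ ((a * b) ^ 2), smul_comm _ ((a * b) ^ 2),
      e]
    module
  · have e := congrArg (fun r => (a * b) ^ 2 • (Z * (Z * r))) r3
    simp only [mul_add, mul_neg, hCan, mul_smul_comm, smul_neg, smul_add] at e
    rw [smul_comm, e]
    module

end QuantumRel
end

theorem quantumRel_hyp {q : K} (hq : IsGeneric q) (c : K) :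
    QuantumRel q (hypX q c) (hypY q c) (hypqH q c) (hypqHInv q c) := by
  have h0 := hq.1
  have hK := hypqH_toHyperboloid hq c
  have hK' := hypqHInv_toHyperboloid hq c
  have hX := hypX_toHyperboloid hq c
  have hY := hypY_toHyperboloid hq c
  constructor <;> refine hyperboloid_hom_ext fun t => ?_ <;>
    simp only [Module.End.mul_apply, LinearMap.smul_apply, LinearMap.add_apply,
      LinearMap.sub_apply, Module.End.one_apply, hK, hK', hX, hY,
      ← map_smul (toHyperboloid q c), ← map_sub,
      ← map_add] <;>
    congr 1
  · exact LinearMap.congr_fun (tensorqH_mul_tensorX q h0) t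
  · exact LinearMap.congr_fun (tensorqH_mul_tensorY q h0) t
  · exact LinearMap.congr_fun (tensorqH_inv_mul_tensorX q h0) t
  · exact LinearMap.congr_fun (tensorqH_inv_mul_tensorY q h0) t
  · exact LinearMap.congr_fun (tensorqH_mul_inv q h0) t
  · exact LinearMap.congr_fun (tensorqH_inv_mul q h0) t
  · exact LinearMap.congr_fun (tensorX_mul_tensorY q hq) t

/-! ### The braided vector fields -/

theorem kappa_eq {q : K} (hq : q ≠ 0) : kappa q = 1 - q ^ 2 * (1 + q ^ 4)⁻¹ := by
  have : q ^ 2 + (q ^ 2)⁻¹ = (q ^ 2)⁻¹ * (1 + q ^ 4) := by field_simp; ring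
  rw [kappa, this, mul_inv, inv_inv]

section
variable {q : K} (hq : IsGeneric q) (c τ : K)

/-- The operator `x'` on the quantum hyperboloid: the element of the quantum group that
corresponds to `x`, divided by the Casimir operator and normalized. -/
def vectorField : V K →ₗ[K] Module.End K (Hyperboloid q c) :=
  (kappa q * τ) • LinearMap.mulLeft K (casimirInv hq c) ∘ₗ
    adjointVec q (hypX q c) (hypY q c) (hypqH q c)

theorem vectorField_eq (x : V K) : vectorField hq c τ x = (kappa q * τ) •
    (casimirInv hq c * adjointVec q (hypX q c) (hypY q c) (hypqH q c) x) := rfl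

theorem commute_casimirInv_adjointVec (x : V K) : Commute (casimirInv hq c)
    (adjointVec q (hypX q c) (hypY q c) (hypqH q c) x) :=
  QuantumRel.commute_adjointVec (commute_casimirInv_hypX hq c)
    (commute_casimirInv_hypY hq c) (commute_casimirInv_hypqH hq c) x

/-- The operators `x'` satisfy the defining relations of the braided enveloping algebra. -/
theorem vectorField_respects ⦃a b : T K⦄ (h : EnvelopingRel q τ a b) :
    TensorAlgebra.lift K (vectorField hq c τ) a = TensorAlgebra.lift K (vectorField hq c τ) b := by
  obtain ⟨b1, b2, b3⟩ := bracket_antisymmetric q τ hq.1 hq.add_inv_ne_zero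
    (hq.one_add_pow_ne_zero four_pos)
  obtain ⟨r1, r2, r3⟩ := (quantumRel_hyp hq c).rescaled_relations hq (C := casimir q c) rfl
    (casimirInv_mul_casimir hq c) (commute_casimirInv_adjointVec hq c) (kappa q) τ
    (vectorField_eq hq c τ)
  cases h
  · rw [b1]
    simp only [map_sub, map_smul, map_mul, TensorAlgebra.lift_ι_apply]
    exact r1
  · rw [b2]
    simp only [map_sub, map_add, map_smul, map_mul, TensorAlgebra.lift_ι_apply]
    exact r2
  · rw [b3]
    simp only [map_add, map_neg, map_smul, map_mul, TensorAlgebra.lift_ι_apply]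
    exact r3

/-- The representation of the braided enveloping algebra by the operators `x'`. -/
def envelopingRep : Enveloping q τ →ₐ[K] Module.End K (Hyperboloid q c) :=
  RingQuot.liftAlgHom K ⟨TensorAlgebra.lift K (vectorField hq c τ), vectorField_respects hq c τ⟩

theorem envelopingRep_toEnveloping (x : V K) :
    envelopingRep hq c τ (toEnveloping q τ x) = vectorField hq c τ x := by
  refine (RingQuot.liftAlgHom_mkAlgHom_apply K (TensorAlgebra.lift K (vectorField hq c τ))
    (vectorField_respects hq c τ) (ι x)).trans ?_
  rw [TensorAlgebra.lift_ι_apply]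

theorem hypY_vectorField (x : V K) (a : Hyperboloid q c) :
    hypY q c (vectorField hq c τ x a) =
      vectorField hq c τ x (hypY q c a) + vectorField hq c τ (actY q x) (hypqH q c a) := by
  have h := LinearMap.congr_fun ((quantumRel_hyp hq c).Y_mul_adjointVec hq x) a
  have hY := LinearMap.congr_fun (commute_casimirInv_hypY hq c).eq
  simp only [Module.End.mul_apply, LinearMap.add_apply] at h hY
  simp only [vectorField_eq, LinearMap.smul_apply, Module.End.mul_apply, map_smul, ← hY, h,
    map_add, smul_add]

theorem hypqH_vectorField (x : V K) (a : Hyperboloid q c) :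
    hypqH q c (vectorField hq c τ x a) = vectorField hq c τ (actqH q x) (hypqH q c a) := by
  have h := LinearMap.congr_fun ((quantumRel_hyp hq c).k_mul_adjointVec hq x) a
  have hY := LinearMap.congr_fun (commute_casimirInv_hypqH hq c).eq
  simp only [Module.End.mul_apply] at h hY
  simp only [vectorField_eq, LinearMap.smul_apply, Module.End.mul_apply, map_smul, ← hY, h]

/-! ### The values of the vector fields on the highest weight vectors -/

theorem hypVec_zero_succ (q c : K) (k : ℕ) : hypVec q c (k + 1) 0 = gen q c u * hypVec q c k 0 := by
  rw [hypVec, spinVec_zero, pow_succ', map_mul, toHyperboloid_ι, hypVec, spinVec_zero]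

include hq

theorem hypY_mul (a b : Hyperboloid q c) :
    hypY q c (a * b) = hypY q c a * hypqH q c b + a * hypY q c b := by
  obtain ⟨s, rfl⟩ := toHyperboloid_surjective q c a
  obtain ⟨t, rfl⟩ := toHyperboloid_surjective q c b
  rw [← map_mul, hypY_toHyperboloid hq, tensorY_mul, map_add, map_mul, map_mul,
    hypY_toHyperboloid hq, hypY_toHyperboloid hq, hypqH_toHyperboloid hq]

theorem hypY_gen (x : V K) : hypY q c (gen q c x) = gen q c (actY q x) := by
  rw [← toHyperboloid_ι, hypY_toHyperboloid hq, tensorY_ι, toHyperboloid_ι]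

/-- `Y u^{k+1} = - [k+1]_{q²} v u^k`. -/
theorem hypVec_one (k : ℕ) :
    hypVec q c (k + 1) 1 = -((q + q⁻¹)⁻¹ * raising q (k + 1) 1) •
      (gen q c v * hypVec q c k 0) := by
  have h0 := hq.1
  have h2 := hq.sq_add_one_ne_zero
  have hs : q ^ 2 - 1 ≠ 0 := sub_ne_zero.2 (hq.2 2 two_pos)
  rw [← hypY_hypVec hq, hypVec_zero_succ, hypY_mul hq, hypY_gen hq, actY_u, hypqH_hypVec hq,
    hypY_hypVec hq, ← neg_one_smul K v, map_smul]
  cases k with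
  | zero =>
    have : hypVec q c 0 (0 + 1) = 0 := by
      rw [hypVec, spinVec_eq_zero hq 0, map_zero]
    rw [this]
    unfold raising
    simp only [mul_zero, zero_add, smul_mul_assoc, mul_smul_comm, pow_zero, pow_one, mul_one]
    match_scalars
    field_simp
    ring
  | succ k =>
    rw [zero_add, hypVec_one k, hypVec_zero_succ]
    simp only [mul_smul_comm, ← mul_assoc, gen_v_mul_gen_u, smul_mul_assoc]
    unfold raising
    have hy : q ^ (2 * (k + 1)) ≠ 0 := pow_ne_zero _ h0
    rw [show 2 * (k + 1 + 1) = 2 * (k + 1) + 2 by ring, pow_add q (2 * (k + 1))]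
    generalize q ^ (2 * (k + 1)) = y at *
    match_scalars
    field_simp
    ring

theorem vectorField_u_highest (k : ℕ) : vectorField hq c τ u (hypVec q c k 0) = 0 := by
  rw [vectorField_eq, adjointVec_u, LinearMap.smul_apply, Module.End.mul_apply,
    Module.End.mul_apply, hypqH_hypVec hq, map_smul, hypX_hypVec_zero hq, smul_zero, map_zero,
    smul_zero]

theorem vectorField_v_highest (k : ℕ) : vectorField hq c τ v (hypVec q c k 0) =
    (kappa q * τ * (casimirValue q k)⁻¹ * (q ^ 2)⁻¹ * raising q k 1) • hypVec q c k 0 := by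
  rw [vectorField_eq, adjointVec_v, LinearMap.smul_apply, Module.End.mul_apply,
    LinearMap.sub_apply, LinearMap.smul_apply, Module.End.mul_apply,
    Module.End.mul_apply, hypY_hypVec hq, hypX_hypVec_zero hq, hypX_hypVec_succ hq, map_zero,
    sub_zero, map_smul, map_smul, casimirInv_hypVec]
  module

theorem vectorField_w_highest (k : ℕ) : vectorField hq c τ w (hypVec q c k 0) =
    (kappa q * τ * (casimirValue q k)⁻¹ * (q ^ 2)⁻¹) • hypVec q c k 1 := by
  rw [vectorField_eq, adjointVec_w, LinearMap.smul_apply, Module.End.mul_apply,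
    LinearMap.smul_apply, hypY_hypVec hq, map_smul, casimirInv_hypVec]
  module


/-- The relation `(q³ + q) u W + v V + (q + q⁻¹) w U = 0` between the vector fields: the left-hand
side commutes with `Y`, since it is the contraction with an invariant tensor, and it vanishes on
the highest weight vectors. -/
theorem vectorField_relation (a : Hyperboloid q c) :
    (q ^ 3 + q) • (gen q c u * vectorField hq c τ w a) + gen q c v * vectorField hq c τ v a +
      (q + q⁻¹) • (gen q c w * vectorField hq c τ u a) = 0 := by
  have h0 := hq.1
  have h2 := hq.sq_add_one_ne_zero
  let Q : Module.End K (Hyperboloid q c) :=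
    (q ^ 3 + q) • (LinearMap.mulLeft K (gen q c u) * vectorField hq c τ w) +
      LinearMap.mulLeft K (gen q c v) * vectorField hq c τ v +
      (q + q⁻¹) • (LinearMap.mulLeft K (gen q c w) * vectorField hq c τ u)
  have hQ (a : Hyperboloid q c) : Q a = (q ^ 3 + q) • (gen q c u * vectorField hq c τ w a) +
      gen q c v * vectorField hq c τ v a + (q + q⁻¹) • (gen q c w * vectorField hq c τ u a) := rfl
  have hYQ (a : Hyperboloid q c) : Q (hypY q c a) = hypY q c (Q a) := by
    simp only [hQ, map_add, map_smul, hypY_mul hq, hypY_gen hq, actY_u, actY_v, actY_w,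
      hypY_vectorField hq, hypqH_vectorField hq, actqH_u, actqH_v, actqH_w, map_zero,
      zero_mul, mul_add, LinearMap.smul_apply, LinearMap.zero_apply, mul_zero,
      ← neg_one_smul K v, mul_smul_comm, smul_mul_assoc]
    match_scalars <;> field_simp <;> ring
  have hQ0 (k i : ℕ) : Q (hypVec q c k i) = 0 := by
    induction i with
    | zero =>
      rw [hQ, vectorField_u_highest hq, vectorField_v_highest hq, vectorField_w_highest hq]
      cases k with
      | zero =>
        have : hypVec q c 0 1 = 0 := by
          rw [hypVec, spinVec_eq_zero hq 0, map_zero]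
        have hr : raising q 0 1 = 0 := by simp [raising, h0]
        simp [this, hr]
      | succ k =>
        rw [hypVec_one hq, hypVec_zero_succ]
        simp only [mul_zero, smul_zero, add_zero, mul_smul_comm, ← mul_assoc, gen_v_mul_gen_u,
          smul_mul_assoc]
        generalize raising q (k + 1) 1 = r
        generalize (casimirValue q (k + 1))⁻¹ = s
        match_scalars
        field_simp
        ring
    | succ i ih => rw [← hypY_hypVec hq, hYQ, ih, map_zero]
  have : Q = 0 := hyperboloid_hom_ext_hypVec hq fun k i => hQ0 k i
  rw [← hQ, this, LinearMap.zero_apply]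

theorem vectorField_one (x : V K) : vectorField hq c τ x 1 = 0 := by
  have h1 : (1 : Hyperboloid q c) = toHyperboloid q c 1 := (map_one _).symm
  have hX : hypX q c 1 = 0 := by rw [h1, hypX_toHyperboloid hq, tensorX_one, map_zero]
  have hY : hypY q c 1 = 0 := by rw [h1, hypY_toHyperboloid hq, tensorY_one, map_zero]
  have hK : hypqH q c 1 = 1 := by rw [h1, hypqH_toHyperboloid hq, tensorqH_one]
  rw [vec_eq x]
  simp [vectorField_eq, adjointVec_u, adjointVec_v, adjointVec_w, hX, hY, hK]

/-! ### Comparison with the braided adjoint action -/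

omit hq in
theorem actY_bracket (h0 : q ≠ 0) (h2 : q ^ 2 + 1 ≠ 0) (x y : V K) :
    actY q (bracket q τ x y) = bracket q τ x (actY q y) + bracket q τ (actY q x) (actqH q y) := by
  ext i
  fin_cases i <;>
    simp [bracket, actY, actqH, Matrix.mulVec, dotProduct, Fin.sum_univ_three] <;> field_simp <;>
    ring

omit hq in
/-- The braided adjoint action on the first tensor factor is equivariant. -/
theorem tensorY_adFirst (h0 : q ≠ 0) (h2 : q ^ 2 + 1 ≠ 0) (x : V K) {k : ℕ} {t : T K}
    (ht : t ∈ tensors K (k + 1)) :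
    tensorY q (adFirst q τ x t) =
      adFirst q τ x (tensorY q t) + adFirst q τ (actY q x) (tensorqH q t) := by
  refine tensors_induction (p := fun t => tensorY q (adFirst q τ x t) =
      adFirst q τ x (tensorY q t) + adFirst q τ (actY q x) (tensorqH q t))
    (fun y s hs => ?_) (fun s t hs ht => ?_) ht
  · rw [adFirst_ι_mul, tensorY_mul, tensorY_mul, tensorqH_mul, tensorY_ι, tensorY_ι, tensorqH_ι,
      map_add, adFirst_ι_mul, adFirst_ι_mul, adFirst_ι_mul, actY_bracket τ h0 h2, map_add, add_mul]
    abel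
  · simp only [map_add, hs, ht]
    abel

theorem toHyperboloid_spinComponent_hypVec (k i : ℕ) :
    toHyperboloid q c (spinComponent hq c k (hypVec q c k i)) = hypVec q c k i := by
  rw [hypVec, spinComponent_toHyperboloid hq c (spinVec_mem_spin q k i)]

theorem alpha_mul_eq (k : ℕ) : alpha q k * ((1 + q ^ 4)⁻¹ * τ) =
    kappa q * τ * (casimirValue q k)⁻¹ * (q ^ 2)⁻¹ * raising q k 1 := by
  have h0 := hq.1
  have h2 : q ^ 2 - 1 ≠ 0 := sub_ne_zero.2 (hq.2 2 two_pos)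
  have h2' := hq.sq_add_one_ne_zero
  have h4 : 1 + q ^ 4 ≠ 0 := hq.one_add_pow_ne_zero four_pos
  have h4' : q ^ 4 - 1 ≠ 0 := sub_ne_zero.2 (hq.2 4 four_pos)
  have hy : q ^ (2 * k) ≠ 0 := pow_ne_zero _ h0
  have hc := casimirValue_ne_zero hq k
  have hsum : ∑ i ∈ Finset.range k, q ^ (4 * i) = ((q ^ (2 * k)) ^ 2 - 1) * (q ^ 4 - 1)⁻¹ := by
    rw [eq_mul_inv_iff_mul_eq₀ h4', ← pow_mul, show 2 * k * 2 = 4 * k by ring, pow_mul q 4 k,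
      ← geom_sum_mul (q ^ 4) k]
    simp only [pow_mul]
  -- the denominator of `α_k` is `q^{2k}` times the value of the Casimir operator
  have hden : q⁻¹ + q ^ (4 * k + 1) = q ^ (2 * k) * casimirValue q k := by
    rw [casimirValue, pow_succ, show 4 * k = 2 * k + 2 * k by ring, pow_add]
    field_simp
    ring
  rw [alpha, hsum, hden, kappa_eq h0, raising, pow_one]
  generalize casimirValue q k = d at *
  generalize q ^ (2 * k) = y at *
  have hs : q - q⁻¹ = (q ^ 2 - 1) * q⁻¹ := by field_simp
  have h4'' : q ^ 4 - 1 = (q ^ 2 - 1) * (q ^ 2 + 1) := by ring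
  rw [hs, h4'']
  field_simp
  ring

/-- The operator `α_k P_k ([x, ·] ⊗ id)` agrees with the vector field `x'` on the highest weight
vector of `V_k^q`. -/
theorem spinProj_adFirst_highest (k : ℕ) (x : V K) :
    alpha q (k + 1) • toHyperboloid q c
      (spinProj hq c (k + 1) (adFirst q τ x (spinVec q (k + 1) 0))) =
    vectorField hq c τ x (hypVec q c (k + 1) 0) := by
  have h0 := hq.1
  have hr : raising q (k + 1) 1 ≠ 0 := raising_ne_zero hq one_pos (by omega)
  have hα := alpha_mul_eq hq τ (k + 1)
  have bu : bracket q τ u u = 0 := by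
    ext i; fin_cases i <;> simp [bracket, u]
  have bv : bracket q τ v u = ((1 + q ^ 4)⁻¹ * τ) • u := by
    ext i; fin_cases i <;> simp [bracket, u, v]
  have bw : bracket q τ w u = (-(q + q⁻¹)⁻¹ * ((1 + q ^ 4)⁻¹ * τ)) • v := by
    ext i; fin_cases i <;> simp [bracket, u, v, w]; ring
  -- `v u^k` is a multiple of `Y u^{k+1}`, so it has no other components
  have hv : gen q c v * hypVec q c k 0 =
      (-((q + q⁻¹)⁻¹ * raising q (k + 1) 1))⁻¹ • hypVec q c (k + 1) 1 := by
    rw [hypVec_one hq, smul_smul, inv_mul_cancel₀, one_smul]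
    exact neg_ne_zero.2 (mul_ne_zero (inv_ne_zero hq.add_inv_ne_zero) hr)
  rw [spinProj_apply, spinVec_zero, pow_succ', adFirst_ι_mul, map_mul, toHyperboloid_ι,
    ← spinVec_zero q, ← hypVec, vec_eq x]
  simp only [map_add, map_smul, LinearMap.add_apply, LinearMap.smul_apply, bu, bv, bw,
    smul_zero, zero_add, add_mul, smul_mul_assoc, ← hypVec_zero_succ, hv,
    toHyperboloid_spinComponent_hypVec, vectorField_u_highest hq, vectorField_v_highest hq,
    vectorField_w_highest hq, ← hα]
  match_scalars
  · ring
  · have hB := hq.add_inv_ne_zero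
    generalize q + q⁻¹ = b at *
    generalize alpha q (k + 1) = a at *
    generalize (1 + q ^ 4)⁻¹ * τ = m at *
    generalize kappa q * τ * (casimirValue q (k + 1))⁻¹ * (q ^ 2)⁻¹ = e at *
    field_simp
    linear_combination x 2 * hα

theorem spinProj_adFirst (k : ℕ) (hk : 1 ≤ k) (x : V K) {t : T K} (ht : t ∈ spin q k) :
    vectorField hq c τ x (toHyperboloid q c t) =
      alpha q k • toHyperboloid q c (spinProj hq c k (adFirst q τ x t)) := by
  obtain ⟨k, rfl⟩ : ∃ l, k = l + 1 := ⟨k - 1, by omega⟩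
  have key (i : ℕ) : ∀ x, vectorField hq c τ x (hypVec q c (k + 1) i) =
      alpha q (k + 1) • toHyperboloid q c
        (spinProj hq c (k + 1) (adFirst q τ x (spinVec q (k + 1) i))) := by
    induction i with
    | zero => exact fun x => (spinProj_adFirst_highest hq c τ k x).symm
    | succ i ih =>
      intro x
      have h1 := tensorY_adFirst τ hq.1 hq.sq_add_one_ne_zero x (spinVec_mem_tensors q (k + 1) i)
      have h2 := hypY_vectorField hq c τ x (hypVec q c (k + 1) i)
      rw [hypY_hypVec hq, ih, map_smul, hypY_toHyperboloid hq,
        ← spinProj_comm hq c (descends_tensorY hq c) (fun _ _ => tensorY_mem_spin), h1, map_add,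
        map_add, smul_add, hypqH_hypVec hq, map_smul, ih, tensorY_spinVec, tensorqH_spinVec q hq.1,
        map_smul, map_smul, map_smul, smul_comm (alpha q (k + 1))] at h2
      exact (add_right_cancel h2).symm
  have : spin q (k + 1) ≤ LinearMap.eqLocus
      (vectorField hq c τ x ∘ₗ (toHyperboloid q c).toLinearMap)
      (alpha q (k + 1) • ((toHyperboloid q c).toLinearMap ∘ₗ spinProj hq c (k + 1) ∘ₗ
        adFirst q τ x)) := by
    conv_lhs => rw [spin]
    rw [Submodule.span_le]
    rintro _ ⟨i, rfl⟩
    exact key i x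
  exact this ht

theorem vectorField_gen (x z : V K) :
    vectorField hq c τ x (gen q c z) = gen q c (bracket q τ x z) := by
  have h0 := hq.1
  -- every element of `V` is in `V_1^q`
  have hmem (y : V K) : ι y ∈ spin q 1 := by
    have hu : ι u ∈ spin q 1 := by simpa [spinVec_zero] using spinVec_mem_spin q 1 0
    have hv : ι v ∈ spin q 1 := by
      have := tensorY_mem_spin hu
      rw [tensorY_ι, actY_u, map_neg] at this
      exact neg_mem_iff.1 this
    have hw : ι w ∈ spin q 1 := by
      have := tensorY_mem_spin hv
      rw [tensorY_ι, actY_v, map_smul] at this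
      exact (Submodule.smul_mem_iff _ hq.add_inv_ne_zero).1 this
    rw [vec_eq y]
    simp only [map_add, map_smul]
    exact add_mem (add_mem (Submodule.smul_mem _ _ hu) (Submodule.smul_mem _ _ hv))
      (Submodule.smul_mem _ _ hw)
  have hα : alpha q 1 = 1 := by
    have : q⁻¹ + q ^ (4 * 1 + 1) ≠ 0 := by
      have h6 := hq.one_add_pow_ne_zero (n := 6) (by omega)
      intro h
      apply h6
      field_simp at h
      linear_combination h
    simp only [alpha, Finset.sum_range_one, mul_zero, pow_zero, mul_one]
    exact mul_inv_cancel₀ this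
  have hz : adFirst q τ x (ι z) = ι (bracket q τ x z) := by
    simpa using adFirst_ι_mul q τ x z 1
  rw [← toHyperboloid_ι, spinProj_adFirst hq c τ 1 le_rfl x (hmem z), hα, one_smul, hz,
    spinProj_of_mem hq c (hmem _), toHyperboloid_ι]

/-! ### The action of the tangent module -/

/-- The map `Z ↦ Z(f)` from the tangent module, for a fixed function `f`: the left `A`-linear map
with `x' ↦ x'(f)`. -/
def tangentEval (f : Hyperboloid q c) : Tangent q c →ₗ[Hyperboloid q c] Hyperboloid q c :=
  (tangentRel q c).liftQ (Fintype.linearCombination (Hyperboloid q c)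
    ![vectorField hq c τ u f, vectorField hq c τ v f, vectorField hq c τ w f]) (by
      rw [tangentRel, Submodule.span_singleton_le_iff_mem, LinearMap.mem_ker,
        Fintype.linearCombination_apply, Fin.sum_univ_three, ← vectorField_relation hq c τ f]
      simp only [Matrix.cons_val, smul_eq_mul, smul_mul_assoc]
      abel)

theorem tangentEval_mk (f : Hyperboloid q c) (Z : Fin 3 → Hyperboloid q c) :
    tangentEval hq c τ f (Submodule.Quotient.mk Z) = Z 0 * vectorField hq c τ u f +
      Z 1 * vectorField hq c τ v f + Z 2 * vectorField hq c τ w f :=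
  (Fintype.linearCombination_apply (Hyperboloid q c) ![vectorField hq c τ u f,
    vectorField hq c τ v f, vectorField hq c τ w f] Z).trans (Fin.sum_univ_three _)

theorem tangentEval_anchor (f : Hyperboloid q c) (x : V K) :
    tangentEval hq c τ f (anchor q c x) = vectorField hq c τ x f := by
  have h : anchor q c x = Submodule.Quotient.mk fun i => algebraMap K (Hyperboloid q c) (x i) := rfl
  rw [h, tangentEval_mk, ← Algebra.smul_def, ← Algebra.smul_def, ← Algebra.smul_def]
  conv_rhs => rw [vec_eq x]
  simp only [map_add, map_smul, LinearMap.add_apply, LinearMap.smul_apply]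

/-- The action `Z ⊗ f ↦ Z(f)` of the tangent module. -/
def tangentAction : Tangent q c ⊗[K] Hyperboloid q c →ₗ[K] Hyperboloid q c :=
  TensorProduct.lift (LinearMap.mk₂ K (fun Z f => tangentEval hq c τ f Z)
    (fun Z Z' f => map_add _ Z Z')
    (fun a Z f => LinearMap.map_smul_of_tower _ a Z)
    (fun Z f g => by
      obtain ⟨Z, rfl⟩ := Submodule.Quotient.mk_surjective _ Z
      simp only [tangentEval_mk, map_add, mul_add]
      abel)
    (fun a Z f => by
      obtain ⟨Z, rfl⟩ := Submodule.Quotient.mk_surjective _ Z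
      simp only [tangentEval_mk, map_smul, mul_smul_comm, smul_add]))

theorem tangentAction_tmul (Z : Tangent q c) (f : Hyperboloid q c) :
    tangentAction hq c τ (Z ⊗ₜ[K] f) = tangentEval hq c τ f Z := rfl

end
end
end QuantumHyperboloid

theorem mainTheorem1 {K : Type*} [RCLike K] (q c τ : K)
    (hq : QuantumHyperboloid.IsGeneric q) (hc : c ≠ 0) (hτ : τ ≠ 0) :
    -- the algebra is the direct sum of its spin components
    Function.Bijective
      (DirectSum.toModule K ℕ (QuantumHyperboloid.Hyperboloid q c) fun k =>
        (QuantumHyperboloid.toHyperboloid q c).toLinearMap ∘ₗ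
          (QuantumHyperboloid.spin q k).subtype) ∧
    ∃ P : ℕ → Module.End K (QuantumHyperboloid.T K),
      (∀ k, QuantumHyperboloid.IsBraidedProjector q k (P k)) ∧
    ∃ β : QuantumHyperboloid.Tangent q c ⊗[K] QuantumHyperboloid.Hyperboloid q c →ₗ[K]
        QuantumHyperboloid.Hyperboloid q c,
      -- compatibility with left multiplication (the commutative square)
      (∀ (a : QuantumHyperboloid.Hyperboloid q c) (X : QuantumHyperboloid.Tangent q c)
        (f : QuantumHyperboloid.Hyperboloid q c), β ((a • X) ⊗ₜ[K] f) = a * β (X ⊗ₜ[K] f)) ∧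
      -- representation of the braided enveloping algebra
      (∃ ρ : QuantumHyperboloid.Enveloping q τ →ₐ[K]
          Module.End K (QuantumHyperboloid.Hyperboloid q c),
        ∀ (x : QuantumHyperboloid.V K) (f : QuantumHyperboloid.Hyperboloid q c),
          ρ (QuantumHyperboloid.toEnveloping q τ x) f =
            β (QuantumHyperboloid.anchor q c x ⊗ₜ[K] f)) ∧
      -- the relation between the operators on the whole algebra
      (∀ f : QuantumHyperboloid.Hyperboloid q c,
        (q ^ 3 + q) • (QuantumHyperboloid.gen q c QuantumHyperboloid.u *
            β (QuantumHyperboloid.anchor q c QuantumHyperboloid.w ⊗ₜ[K] f)) +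
          QuantumHyperboloid.gen q c QuantumHyperboloid.v *
            β (QuantumHyperboloid.anchor q c QuantumHyperboloid.v ⊗ₜ[K] f) +
          (q + q⁻¹) • (QuantumHyperboloid.gen q c QuantumHyperboloid.w *
            β (QuantumHyperboloid.anchor q c QuantumHyperboloid.u ⊗ₜ[K] f)) = 0) ∧
      -- the operators extend the braided adjoint action
      (∀ x : QuantumHyperboloid.V K, β (QuantumHyperboloid.anchor q c x ⊗ₜ[K] 1) = 0) ∧
      (∀ x z : QuantumHyperboloid.V K,
        β (QuantumHyperboloid.anchor q c x ⊗ₜ[K] QuantumHyperboloid.gen q c z) =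
          QuantumHyperboloid.gen q c (QuantumHyperboloid.bracket q τ x z)) ∧
      -- the operators on the spin `k` components
      (∀ k : ℕ, 1 ≤ k → ∀ x : QuantumHyperboloid.V K, ∀ t ∈ QuantumHyperboloid.spin q k,
        β (QuantumHyperboloid.anchor q c x ⊗ₜ[K] QuantumHyperboloid.toHyperboloid q c t) =
          QuantumHyperboloid.alpha q k • QuantumHyperboloid.toHyperboloid q c
            (P k (QuantumHyperboloid.adFirst q τ x t))) := by
  open QuantumHyperboloid in
  refine ⟨fromSpin_bijective hq c, spinProj hq c, isBraidedProjector_spinProj hq c,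
    tangentAction hq c τ, fun a Z f => ?_, ⟨envelopingRep hq c τ, fun x f => ?_⟩, fun f => ?_,
    fun x => ?_, fun x z => ?_, fun k hk x t ht => ?_⟩
  · rw [tangentAction_tmul, tangentAction_tmul, map_smul, smul_eq_mul]
  all_goals simp only [tangentAction_tmul, tangentEval_anchor]
  · rw [envelopingRep_toEnveloping]
  · exact vectorField_relation hq c τ f
  · exact vectorField_one hq c τ x
  · exact vectorField_gen hq c τ x z
  · exact spinProj_adFirst hq c τ k hk x ht
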